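/- In $\mathbb C^{1+8}$ with coordinates $(z,w)=(z,w^1,\dots,w^8)$ let $\mathbb M^1$ be the rigid real analytic CR-generic submanifold given by the eight equations $$\begin{aligned} w^1-\overline w^1&=2i\,z\overline z, & w^2-\overline w^2&=2i\,(z^2\overline z+z\overline z^2),\\ w^3-\overline w^3&=2\,(z^2\overline z-z\overline z^2), & w^4-\overline w^4&=2i\,(z^3\overline z+z\overline z^3),\\ w^5-\overline w^5&=2\,(z^3\overline z-z\overline z^3), & w^6-\overline w^6&=2i\,z^2\overline z^2,\\ w^7-\overline w^7&=2i\,(z^4\overline z+z\overline z^4), & w^8-\overline w^8&=2\,(z^4\overline z-z\overline z^4). \end{aligned}$$ Let $S\subset\mathbb M^1$ be a connected set containing the origin (for instance $S=\{0\}$ or $S=\mathbb M^1$). Let $\mathfrak{aut}_{CR}(\mathbb M^1)$ be the real Lie algebra, under the commutator of vector fields, of infinitesimal CR-automorphisms of $\mathbb M^1$ near $S$: its elements are the vector fields ${\sf X}=Z(z,w)\,\partial_z+\sum_{l=1}^8W^l(z,w)\,\partial_{w^l}$ with coefficients holomorphic in a neighbourhood of $S$, identified when they agree in a neighbourhood of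 $S$, such that ${\sf X}+\overline{\sf X}$ is tangent to $\mathbb M^1$ at the points of $\mathbb M^1$ in a neighbourhood of $S$. (For $S=\{0\}$ these are germs at the origin; for $S=\mathbb M^1$ they are the fields defined near $\mathbb M^1$ and tangent to it everywhere.) Then $\mathfrak{aut}_{CR}(\mathbb M^1)$ has real dimension $12$, and the following twelve holomorphic vector fields form a basis of it over $\mathbb R$: $$\begin{aligned} {\sf X}_i&=\partial_{w^i}\qquad(i=1,\dots,8),\\ {\sf X}_9&=z\partial_z+2w^1\partial_{w^1}+3w^2\partial_{w^2}+3w^3\partial_{w^3}+4w^4\partial_{w^4}+4w^5\partial_{w^5}+4w^6\partial_{w^6}+5w^7\partial_{w^7}+5w^8\partial_{w^8},\\ {\sf X}_{10}&=iz\partial_z-w^3\partial_{w^2}+w^2\partial_{w^3}-2w^5\partial_{w^4}+2w^4\partial_{w^5}-3w^8\partial_{w^7}+3w^7\partial_{w^8},\\ {\sf X}_{11}&=\partial_z+2iz\,\partial_{w^1}+(4w^1+2iz^2)\partial_{w^2}+2z^2\partial_{w^3}+(3w^2+2iz^3)\partial_{w^4}+(3w^3+2z^3)\partial_{w^5}\\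 &\quad+2w^2\partial_{w^6}+(4w^4+2iz^4)\partial_{w^7}+(4w^5+2z^4)\partial_{w^8},\\ {\sf X}_{12}&=i\partial_z+2z\,\partial_{w^1}+2z^2\partial_{w^2}+(4w^1-2iz^2)\partial_{w^3}+(-3w^3+2z^3)\partial_{w^4}+(3w^2-2iz^3)\partial_{w^5}\\ &\quad+2w^3\partial_{w^6}+(-4w^5+2z^4)\partial_{w^7}+(4w^4-2iz^4)\partial_{w^8}. \end{aligned}$$ Moreover it is a graded Lie algebra $$\mathfrak{aut}_{CR}(\mathbb M^1)=\mathfrak g_{-5}\oplus\mathfrak g_{-4}\oplus\mathfrak g_{-3}\oplus\mathfrak g_{-2}\oplus\mathfrak g_{-1}\oplus\mathfrak g_0,\qquad[\mathfrak g_i,\mathfrak g_j]\subset\mathfrak g_{i+j}$$ (with $\mathfrak g_k=0$ for $k\notin\{-5,\dots,0\}$), where, with real spans, $$\mathfrak g_{-5}=\langle{\sf X}_7,{\sf X}_8\rangle,\ \ \mathfrak g_{-4}=\langle{\sf X}_4,{\sf X}_5,{\sf X}_6\rangle,\ \ \mathfrak g_{-3}=\langle{\sf X}_2,{\sf X}_3\rangle,\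 \ \mathfrak g_{-2}=\langle{\sf X}_1\rangle,\ \ \mathfrak g_{-1}=\langle{\sf X}_{11},{\sf X}_{12}\rangle,\ \ \mathfrak g_0=\langle{\sf X}_9,{\sf X}_{10}\rangle,$$ and its commutators $[{\sf X}_i,{\sf X}_j]$ (row $i$, column $j$, $i\le j$; the others follow by skew-symmetry) are given as follows. All $[{\sf X}_i,{\sf X}_j]$ with $i,j\le 8$ vanish, and $$\begin{array}{c|cccc} &{\sf X}_9&{\sf X}_{10}&{\sf X}_{11}&{\sf X}_{12}\\\hline {\sf X}_1&2{\sf X}_1&0&4{\sf X}_2&4{\sf X}_3\\ {\sf X}_2&3{\sf X}_2&{\sf X}_3&3{\sf X}_4+2{\sf X}_6&3{\sf X}_5\\ {\sf X}_3&3{\sf X}_3&-{\sf X}_2&3{\sf X}_5&-3{\sf X}_4+2{\sf X}_6\\ {\sf X}_4&4{\sf X}_4&2{\sf X}_5&4{\sf X}_7&4{\sf X}_8\\ {\sf X}_5&4{\sf X}_5&-2{\sf X}_4&4{\sf X}_8&-4{\sf X}_7\\ {\sf X}_6&4{\sf X}_6&0&0&0\\ {\sf X}_7&5{\sf X}_7&3{\sf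 X}_8&0&0\\ {\sf X}_8&5{\sf X}_8&-3{\sf X}_7&0&0\\ {\sf X}_9&0&0&-{\sf X}_{11}&-{\sf X}_{12}\\ {\sf X}_{10}&\ast&0&-{\sf X}_{12}&{\sf X}_{11}\\ {\sf X}_{11}&\ast&\ast&0&4{\sf X}_1\\ {\sf X}_{12}&\ast&\ast&\ast&0 \end{array}$$ -/

import Mathlib

open Filter Topology ComplexConjugate

/-- The ambient space `ℂ^{1+8}`, with points `q = (z, w)`; `w j` is the coordinate usually
written `w^{j+1}`. -/
abbrev C9 : Type := ℂ × (Fin 8 → ℂ)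

/-! ### The Lie algebra of germs of holomorphic vector fields -/

/-- Germs along `S` of holomorphic vector fields `Z ∂_z + ∑ W^l ∂_{w^l}`, each field being
identified with its coefficient map `(Z, W)`. An element is represented by a map that is
holomorphic in a neighbourhood of `S`, two such maps being identified when they agree in a
neighbourhood of `S`. -/
def holGerms (S : Set C9) : Submodule ℝ (Germ (𝓝ˢ S) C9) where
  carrier := {g | ∃ X : C9 → C9, AnalyticOnNhd ℂ X S ∧ (X : Germ (𝓝ˢ S) C9) = g}
  add_mem' := by
    rintro _ _ ⟨X, hX, rfl⟩ ⟨Y, hY, rfl⟩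
    exact ⟨X + Y, hX.add hY, rfl⟩
  zero_mem' := ⟨0, analyticOnNhd_const, rfl⟩
  smul_mem' := by
    rintro c _ ⟨X, hX, rfl⟩
    refine ⟨c • X, ?_, rfl⟩
    have h : c • X = (c : ℂ) • X := by
      funext q
      simp
    rw [h]
    exact hX.const_smul

theorem lieBracket_eventuallyEq_nhdsSet {S : Set C9} {X X' Y Y' : C9 → C9}
    (hX : X =ᶠ[𝓝ˢ S] X') (hY : Y =ᶠ[𝓝ˢ S] Y') :
    VectorField.lieBracket ℂ X Y =ᶠ[𝓝ˢ S] VectorField.lieBracket ℂ X' Y' := by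
  have hX' := eventually_nhdsSet_iff_forall.1 hX
  have hY' := eventually_nhdsSet_iff_forall.1 hY
  refine eventually_nhdsSet_iff_forall.2 fun s hs => ?_
  exact Filter.EventuallyEq.lieBracket_vectorField (hX' s hs) (hY' s hs)

theorem analyticOnNhd_lieBracket {S : Set C9} {X Y : C9 → C9}
    (hX : AnalyticOnNhd ℂ X S) (hY : AnalyticOnNhd ℂ Y S) :
    AnalyticOnNhd ℂ (VectorField.lieBracket ℂ X Y) S := fun s hs =>
  ((hX s hs).contDiffAt.lieBracket_vectorField (m := ⊤) (hY s hs).contDiffAt le_rfl).analyticAt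

/-- The Lie bracket of vector fields, `[X, Y] = X(Y) - Y(X)` on coefficients, for germs. -/
noncomputable def germBracket {S : Set C9} : Germ (𝓝ˢ S) C9 → Germ (𝓝ˢ S) C9 → Germ (𝓝ˢ S) C9 :=
  Quotient.map₂ (VectorField.lieBracket ℂ)
    fun _ _ hX _ _ hY => lieBracket_eventuallyEq_nhdsSet hX hY

theorem germBracket_coe {S : Set C9} (X Y : C9 → C9) :
    germBracket (X : Germ (𝓝ˢ S) C9) Y = (VectorField.lieBracket ℂ X Y : C9 → C9) := rfl

theorem germBracket_mem {S : Set C9} {f g : Germ (𝓝ˢ S) C9} (hf : f ∈ holGerms S)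
    (hg : g ∈ holGerms S) : germBracket f g ∈ holGerms S := by
  obtain ⟨X, hX, rfl⟩ := hf
  obtain ⟨Y, hY, rfl⟩ := hg
  exact ⟨_, analyticOnNhd_lieBracket hX hY, rfl⟩

theorem coe_eq_of_eqOn {S : Set C9} {X Y : C9 → C9}
    (h : ∀ s ∈ S, ∀ᶠ q in 𝓝 s, X q = Y q) : (X : Germ (𝓝ˢ S) C9) = Y :=
  Germ.coe_eq.2 (eventually_nhdsSet_iff_forall.2 h)

theorem eventually_differentiableAt_of_analyticAt {X : C9 → C9} {s : C9} (h : AnalyticAt ℂ X s) :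
    ∀ᶠ q in 𝓝 s, DifferentiableAt ℂ X q :=
  h.eventually_analyticAt.mono fun _ hq => hq.differentiableAt

theorem germBracket_add_right {S : Set C9} {f g h : Germ (𝓝ˢ S) C9} (hg : g ∈ holGerms S)
    (hh : h ∈ holGerms S) : germBracket f (g + h) = germBracket f g + germBracket f h := by
  induction f using Germ.inductionOn with | _ X
  obtain ⟨Y, hY, rfl⟩ := hg
  obtain ⟨Z, hZ, rfl⟩ := hh
  refine coe_eq_of_eqOn fun s hs => ?_
  filter_upwards [eventually_differentiableAt_of_analyticAt (hY s hs), eventually_differentiableAt_of_analyticAt (hZ s hs)]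
    with q h1 h2
  exact VectorField.lieBracket_add_right h1 h2

theorem germBracket_swap {S : Set C9} (f g : Germ (𝓝ˢ S) C9) :
    germBracket f g = -germBracket g f := by
  induction f using Germ.inductionOn with | _ X
  induction g using Germ.inductionOn with | _ Y
  refine coe_eq_of_eqOn fun s _ => Eventually.of_forall fun q => ?_
  exact VectorField.lieBracket_swap

theorem germBracket_smul_right {S : Set C9} (c : ℝ) {f g : Germ (𝓝ˢ S) C9}
    (hg : g ∈ holGerms S) : germBracket f (c • g) = c • germBracket f g := by
  induction f using Germ.inductionOn with | _ X
  obtain ⟨Y, hY, rfl⟩ := hg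
  refine coe_eq_of_eqOn fun s hs => ?_
  filter_upwards [eventually_differentiableAt_of_analyticAt (hY s hs)] with q h1
  have h : c • Y = (c : ℂ) • Y := by
    funext q
    simp
  change VectorField.lieBracket ℂ X (c • Y) q = c • VectorField.lieBracket ℂ X Y q
  rw [h, VectorField.lieBracket_const_smul_right h1]
  simp

theorem germBracket_leibniz {S : Set C9} {f g h : Germ (𝓝ˢ S) C9} (hf : f ∈ holGerms S)
    (hg : g ∈ holGerms S) (hh : h ∈ holGerms S) :
    germBracket f (germBracket g h) =
      germBracket (germBracket f g) h + germBracket g (germBracket f h) := by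
  obtain ⟨X, hX, rfl⟩ := hf
  obtain ⟨Y, hY, rfl⟩ := hg
  obtain ⟨Z, hZ, rfl⟩ := hh
  refine coe_eq_of_eqOn fun s hs => ?_
  filter_upwards [(hX s hs).eventually_analyticAt, (hY s hs).eventually_analyticAt,
    (hZ s hs).eventually_analyticAt] with q h1 h2 h3
  exact VectorField.leibniz_identity_lieBracket (n := ⊤) le_top h1.contDiffAt h2.contDiffAt
    h3.contDiffAt

noncomputable instance holGermsLieRing (S : Set C9) : LieRing (holGerms S) where
  bracket f g := ⟨germBracket f.1 g.1, germBracket_mem f.2 g.2⟩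
  add_lie f g h := by
    apply Subtype.ext
    change germBracket (f.1 + g.1) h.1 = germBracket f.1 h.1 + germBracket g.1 h.1
    rw [germBracket_swap, germBracket_add_right f.2 g.2, germBracket_swap f.1,
      germBracket_swap g.1]
    abel
  lie_add f g h := Subtype.ext (germBracket_add_right g.2 h.2)
  lie_self f := by
    apply Subtype.ext
    change germBracket f.1 f.1 = 0
    obtain ⟨X, hX, h⟩ := f.2
    rw [← h, germBracket_coe, VectorField.lieBracket_self]
    rfl
  leibniz_lie f g h := Subtype.ext (germBracket_leibniz f.2 g.2 h.2)

/-- Germs along `S` of holomorphic vector fields form a real Lie algebra under the usual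
commutator. -/
noncomputable instance holGermsLieAlgebra (S : Set C9) : LieAlgebra ℝ (holGerms S) where
  lie_smul c _ g := Subtype.ext (germBracket_smul_right c g.2)

/-! ### The model and its infinitesimal CR-automorphisms -/

/-- The right-hand sides `Ξ_1, …, Ξ_8` of the defining equations. -/
noncomputable def Xi (z : ℂ) : Fin 8 → ℂ :=
  ![2 * Complex.I * (z * conj z),
    2 * Complex.I * (z ^ 2 * conj z + z * conj z ^ 2),
    2 * (z ^ 2 * conj z - z * conj z ^ 2),
    2 * Complex.I * (z ^ 3 * conj z + z * conj z ^ 3),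
    2 * (z ^ 3 * conj z - z * conj z ^ 3),
    2 * Complex.I * (z ^ 2 * conj z ^ 2),
    2 * Complex.I * (z ^ 4 * conj z + z * conj z ^ 4),
    2 * (z ^ 4 * conj z - z * conj z ^ 4)]

/-- The defining functions `w^j - conj w^j - Ξ_j(z, conj z)`. -/
noncomputable def rho (j : Fin 8) (q : C9) : ℂ := q.2 j - conj (q.2 j) - Xi q.1 j

/-- The model `𝕄¹ ⊂ ℂ^{1+8}`. -/
def M1 : Set C9 := {q | ∀ j, rho j q = 0}

/-- `X + conj X` is tangent to `𝕄¹` at `q`: it annihilates all defining functions there.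
For a function `f`, one has `(X + conj X) f = df(X)`, the real differential of `f` applied to
the coefficient vector of `X`. -/
def IsTangentAt (X : C9 → C9) (q : C9) : Prop := ∀ j, fderiv ℝ (rho j) q (X q) = 0

theorem contDiff_Xi (j : Fin 8) : ContDiff ℝ ⊤ fun z => Xi z j := by
  have hc : ContDiff ℝ ⊤ (fun z : ℂ => conj z) := Complex.conjCLE.contDiff
  fin_cases j <;> simp [Xi] <;> fun_prop

theorem contDiff_rho (j : Fin 8) : ContDiff ℝ ⊤ (rho j) := by
  have h1 : ContDiff ℝ ⊤ (fun q : C9 => q.2 j) := by fun_prop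
  have h2 : ContDiff ℝ ⊤ (fun q : C9 => conj (q.2 j)) := Complex.conjCLE.contDiff.comp h1
  have h3 : ContDiff ℝ ⊤ (fun q : C9 => Xi q.1 j) := (contDiff_Xi j).comp contDiff_fst
  exact (h1.sub h2).sub h3

theorem conj_rho (j : Fin 8) (q : C9) : conj (rho j q) = -rho j q := by
  have h : conj (Xi q.1 j) = -Xi q.1 j := by
    have h2 : conj (2 : ℂ) = 2 := Complex.conj_ofNat 2
    fin_cases j <;> simp [Xi, h2] <;> ring
  simp only [rho, map_sub, Complex.conj_conj, h]
  ring

/-- The projection `(z, w) ↦ (z, w - ρ(z, w) / 2)` of the ambient space onto `𝕄¹`. -/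
noncomputable def retract (q : C9) : C9 := (q.1, fun j => q.2 j - (1 / 2 : ℝ) • rho j q)

theorem retract_mem (q : C9) : retract q ∈ M1 := by
  intro j
  have h := conj_rho j q
  have h' : rho j q = q.2 j - conj (q.2 j) - Xi q.1 j := rfl
  change (q.2 j - (1 / 2 : ℝ) • rho j q) - conj (q.2 j - (1 / 2 : ℝ) • rho j q) - Xi q.1 j = 0
  simp only [map_sub, Complex.real_smul, map_mul, Complex.conj_ofReal, h]
  push_cast
  linear_combination -h'

theorem retract_of_mem {q : C9} (hq : q ∈ M1) : retract q = q := by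
  refine Prod.ext rfl ?_
  funext j
  simp [retract, hq j]

theorem hasFDerivAt_retract (q : C9) :
    HasFDerivAt retract ((ContinuousLinearMap.fst ℝ ℂ (Fin 8 → ℂ)).prod
      (ContinuousLinearMap.pi fun j =>
        ((ContinuousLinearMap.proj j).comp (ContinuousLinearMap.snd ℝ ℂ (Fin 8 → ℂ))) -
          (1 / 2 : ℝ) • fderiv ℝ (rho j) q)) q := by
  refine HasFDerivAt.prodMk hasFDerivAt_fst (hasFDerivAt_pi.2 fun j => ?_)
  refine HasFDerivAt.sub ?_ ?_
  · exact ((ContinuousLinearMap.proj (R := ℝ) (φ := fun _ : Fin 8 => ℂ) j).comp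
      (ContinuousLinearMap.snd ℝ ℂ (Fin 8 → ℂ))).hasFDerivAt
  · exact ((contDiff_rho j).differentiable (by simp) q).hasFDerivAt.const_smul (1 / 2 : ℝ)

/-- A function that vanishes on `𝕄¹` has zero derivative in tangential directions. -/
theorem fderiv_eq_zero_of_vanish {f : C9 → ℂ} {X : C9 → C9} {q : C9} (hq : q ∈ M1)
    (hf : DifferentiableAt ℝ f q) (h0 : ∀ᶠ p in 𝓝 q, p ∈ M1 → f p = 0)
    (hX : IsTangentAt X q) : fderiv ℝ f q (X q) = 0 := by
  have hr := hasFDerivAt_retract q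
  have hrq := retract_of_mem hq
  have hf' : HasFDerivAt f (fderiv ℝ f q) (retract q) := by
    rw [hrq]
    exact hf.hasFDerivAt
  have hcomp := hf'.comp q hr
  have hz : (f ∘ retract) =ᶠ[𝓝 q] fun _ => 0 := by
    have hc : Tendsto retract (𝓝 q) (𝓝 q) := by
      have := hr.continuousAt.tendsto
      rwa [hrq] at this
    filter_upwards [hc.eventually h0] with p hp
    exact hp (retract_mem p)
  have hfd := (hcomp.congr_of_eventuallyEq hz.symm).unique (hasFDerivAt_const (0 : ℂ) q)
  have happ := DFunLike.congr_fun hfd (X q)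
  have hv : ((ContinuousLinearMap.fst ℝ ℂ (Fin 8 → ℂ)).prod
      (ContinuousLinearMap.pi fun j =>
        ((ContinuousLinearMap.proj j).comp (ContinuousLinearMap.snd ℝ ℂ (Fin 8 → ℂ))) -
          (1 / 2 : ℝ) • fderiv ℝ (rho j) q)) (X q) = X q := by
    refine Prod.ext rfl ?_
    funext j
    simp [hX j]
  rw [ContinuousLinearMap.comp_apply, hv] at happ
  simpa using happ

theorem isTangentAt_lieBracket {X Y : C9 → C9} {q : C9} (hq : q ∈ M1)
    (hX : AnalyticAt ℂ X q) (hY : AnalyticAt ℂ Y q)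
    (hXt : ∀ᶠ p in 𝓝 q, p ∈ M1 → IsTangentAt X p)
    (hYt : ∀ᶠ p in 𝓝 q, p ∈ M1 → IsTangentAt Y p) :
    IsTangentAt (VectorField.lieBracket ℂ X Y) q := by
  intro j
  have hXd := hX.differentiableAt
  have hYd := hY.differentiableAt
  have hb : VectorField.lieBracket ℂ X Y q = VectorField.lieBracket ℝ X Y q := by
    simp only [VectorField.lieBracket, hXd.fderiv_restrictScalars ℝ,
      hYd.fderiv_restrictScalars ℝ, ContinuousLinearMap.coe_restrictScalars']
  have hXr : DifferentiableAt ℝ X q := hXd.restrictScalars ℝ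
  have hYr : DifferentiableAt ℝ Y q := hYd.restrictScalars ℝ
  have hρ : DifferentiableAt ℝ (fderiv ℝ (rho j)) q :=
    ((contDiff_rho j).fderiv_right (m := 1) le_top).differentiable (by simp) q
  rw [hb, VectorField.fderiv_apply_lieBracket (n := ⊤) (contDiff_rho j).contDiffAt le_top hYr hXr,
    fderiv_eq_zero_of_vanish hq (hρ.clm_apply hYr) (hYt.mono fun p hp hm => hp hm j)
      (hXt.self_of_nhds hq),
    fderiv_eq_zero_of_vanish hq (hρ.clm_apply hXr) (hXt.mono fun p hp hm => hp hm j)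
      (hYt.self_of_nhds hq), sub_zero]

/-- The Lie algebra of infinitesimal CR-automorphisms of `𝕄¹` along `S`: germs along `S` of
holomorphic vector fields `X` with `X + conj X` tangent to `𝕄¹` at all points of `𝕄¹` in a
neighbourhood of `S`. For `S = {0}` these are the germs at the origin, and for `S = 𝕄¹` the
fields that are holomorphic in a neighbourhood of `𝕄¹` and tangent to `𝕄¹` everywhere. -/
def autCR (S : Set C9) : LieSubalgebra ℝ (holGerms S) where
  carrier := {g | ∃ X : C9 → C9, (X : Germ (𝓝ˢ S) C9) = g ∧
    ∀ᶠ q in 𝓝ˢ S, q ∈ M1 → IsTangentAt X q}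
  add_mem' := by
    rintro f g ⟨X, hX, hXt⟩ ⟨Y, hY, hYt⟩
    refine ⟨X + Y, ?_, ?_⟩
    · rw [Germ.coe_add, hX, hY]
      rfl
    · filter_upwards [hXt, hYt] with q h1 h2 hq j
      rw [Pi.add_apply, map_add, h1 hq j, h2 hq j, add_zero]
  zero_mem' := ⟨0, rfl, Eventually.of_forall fun q _ j => by simp⟩
  smul_mem' := by
    rintro c f ⟨X, hX, hXt⟩
    refine ⟨c • X, ?_, ?_⟩
    · rw [Germ.coe_smul, hX]
      rfl
    · filter_upwards [hXt] with q h1 hq j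
      rw [Pi.smul_apply, map_smul, h1 hq j, smul_zero]
  lie_mem' := by
    rintro ⟨_, X, hX, rfl⟩ ⟨_, Y, hY, rfl⟩ ⟨X', hX', hXt⟩ ⟨Y', hY', hYt⟩
    refine ⟨VectorField.lieBracket ℂ X Y, rfl, ?_⟩
    replace hXt : ∀ᶠ q in 𝓝ˢ S, q ∈ M1 → IsTangentAt X q := by
      filter_upwards [hXt, Germ.coe_eq.1 hX'] with q h1 h2 hq j
      rw [← h2]
      exact h1 hq j
    replace hYt : ∀ᶠ q in 𝓝ˢ S, q ∈ M1 → IsTangentAt Y q := by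
      filter_upwards [hYt, Germ.coe_eq.1 hY'] with q h1 h2 hq j
      rw [← h2]
      exact h1 hq j
    refine eventually_nhdsSet_iff_forall.2 fun s hs => ?_
    filter_upwards [(hX s hs).eventually_analyticAt, (hY s hs).eventually_analyticAt,
      (eventually_nhdsSet_iff_forall.1 hXt s hs).eventually_nhds,
      (eventually_nhdsSet_iff_forall.1 hYt s hs).eventually_nhds] with q h1 h2 h3 h4 hq
    exact isTangentAt_lieBracket hq h1 h2 h3 h4

/-! ### The explicit fields, the gradation and the commutator table

Indices start at `0`: the entry `i` belongs to the field `X_{i+1}`, and `w j` is `w^{j+1}`. -/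

/-- The values at `(z, w)` of the fields `X_1, …, X_12`. -/
noncomputable def fieldValues (z : ℂ) (w : Fin 8 → ℂ) : Fin 12 → C9 :=
  ![(0, Pi.single 0 1), (0, Pi.single 1 1), (0, Pi.single 2 1), (0, Pi.single 3 1),
    (0, Pi.single 4 1), (0, Pi.single 5 1), (0, Pi.single 6 1), (0, Pi.single 7 1),
    (z, ![2 * w 0, 3 * w 1, 3 * w 2, 4 * w 3, 4 * w 4, 4 * w 5, 5 * w 6, 5 * w 7]),
    (Complex.I * z,
      ![0, -w 2, w 1, -2 * w 4, 2 * w 3, 0, -3 * w 7, 3 * w 6]),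
    (1,
      ![2 * Complex.I * z,
        4 * w 0 + 2 * Complex.I * z ^ 2,
        2 * z ^ 2,
        3 * w 1 + 2 * Complex.I * z ^ 3,
        3 * w 2 + 2 * z ^ 3,
        2 * w 1,
        4 * w 3 + 2 * Complex.I * z ^ 4,
        4 * w 4 + 2 * z ^ 4]),
    (Complex.I,
      ![2 * z,
        2 * z ^ 2,
        4 * w 0 - 2 * Complex.I * z ^ 2,
        -3 * w 2 + 2 * z ^ 3,
        3 * w 1 - 2 * Complex.I * z ^ 3,
        2 * w 2,
        -4 * w 4 + 2 * z ^ 4,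
        4 * w 3 - 2 * Complex.I * z ^ 4])]

/-- The holomorphic vector fields `X_1, …, X_12` on `ℂ^{1+8}`. -/
noncomputable def fieldX (i : Fin 12) (q : C9) : C9 := fieldValues q.1 q.2 i

/-- The homogeneous components `𝔤_k` spanned by the members of a family `X`;
`𝔤_k = 0` unless `-5 ≤ k ≤ 0`. -/
def gradedPiece {V : Type*} [AddCommGroup V] [Module ℝ V] (X : Fin 12 → V) (k : ℤ) :
    Submodule ℝ V :=
  if k = -5 then Submodule.span ℝ {X 6, X 7}
  else if k = -4 then Submodule.span ℝ {X 3, X 4, X 5}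
  else if k = -3 then Submodule.span ℝ {X 1, X 2}
  else if k = -2 then Submodule.span ℝ {X 0}
  else if k = -1 then Submodule.span ℝ {X 10, X 11}
  else if k = 0 then Submodule.span ℝ {X 8, X 9}
  else ⊥

/-- The table of commutators of a family `X`. Only the entries on and above the diagonal are
meaningful; those below it are filled with `0`. -/
def commTable {V : Type*} [AddCommGroup V] [Module ℝ V] (X : Fin 12 → V) :
    Fin 12 → Fin 12 → V :=
  ![![0, 0, 0, 0, 0, 0, 0, 0, (2 : ℝ) • X 0, 0, (4 : ℝ) • X 1, (4 : ℝ) • X 2],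
    ![0, 0, 0, 0, 0, 0, 0, 0, (3 : ℝ) • X 1, X 2,
      (3 : ℝ) • X 3 + (2 : ℝ) • X 5, (3 : ℝ) • X 4],
    ![0, 0, 0, 0, 0, 0, 0, 0, (3 : ℝ) • X 2, -X 1,
      (3 : ℝ) • X 4, (-3 : ℝ) • X 3 + (2 : ℝ) • X 5],
    ![0, 0, 0, 0, 0, 0, 0, 0, (4 : ℝ) • X 3, (2 : ℝ) • X 4, (4 : ℝ) • X 6, (4 : ℝ) • X 7],
    ![0, 0, 0, 0, 0, 0, 0, 0, (4 : ℝ) • X 4, (-2 : ℝ) • X 3, (4 : ℝ) • X 7, (-4 : ℝ) • X 6],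
    ![0, 0, 0, 0, 0, 0, 0, 0, (4 : ℝ) • X 5, 0, 0, 0],
    ![0, 0, 0, 0, 0, 0, 0, 0, (5 : ℝ) • X 6, (3 : ℝ) • X 7, 0, 0],
    ![0, 0, 0, 0, 0, 0, 0, 0, (5 : ℝ) • X 7, (-3 : ℝ) • X 6, 0, 0],
    ![0, 0, 0, 0, 0, 0, 0, 0, 0, 0, -X 10, -X 11],
    ![0, 0, 0, 0, 0, 0, 0, 0, 0, 0, -X 11, X 10],
    ![0, 0, 0, 0, 0, 0, 0, 0, 0, 0, 0, (4 : ℝ) • X 0],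
    ![0, 0, 0, 0, 0, 0, 0, 0, 0, 0, 0, 0]]

/-! ### Reflection on real slices -/

/-! Indices run from 0 as in the code: W^l is the coefficient of ∂/∂w^l and ∂_j the derivative in
w^j, with j, l in 0..7.

Upper bound. 𝕄¹ is parametrized by (z, u) in ℂ × ℝ⁸ through w = u + Ξ(z, z̄)/2, and tangency says
that W^l − Ξ^l_z Z is real there. Replacing z̄ by an independent variable ζ and applying Schwarz
reflection turns this into a holomorphic identity T(z, ζ) = conj T(ζ̄, z̄) (`polarCoeff_eq_conj`).
At ζ = 0 it expresses W^l(z, u) through W^l(0, u) and conj Z(0, u) (`snd_eq`). Its first derivative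
at ζ = 0 is `linear_relation`; for l = 0 this makes Z(z, u) a polynomial of degree at most 5 in z,
and comparing powers of z for l = 3, 5, 6 gives the relations in `coeffs`. The direction w^5 is
invisible to first order in ζ, because Ξ_5 = 2i z²ζ². The missing fact ∂_5 W^6 = 0 comes from the
order ε⁴ along the curve z = ζ = ε (`dW_five_six_eq_zero`).

The equations of 𝕄¹ involve w only through w − w̄, so each ∂_j X is again an infinitesimal
automorphism and satisfies the same relations. Combining these with symmetry of second derivatives
gives ∂_k Z = 0 and ∂_k ∂_z Z = 0 at all points (0, u) (`dW_fst`, `fderiv_dW_fst`). Hence Z is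
affine in z with coefficients independent of w; once Z vanishes, all ∂_j W^l vanish too. So X is
determined near 0 by Z(0) in ℂ, ∂_z Z(0) in ℂ and the real vector W(0) in ℝ⁸, that is, by 12 real
parameters (`eventually_eq_zero`).

Lower bound and structure. The twelve explicit fields are tangent by direct computation and realize
these parameters independently. Equality near 0 propagates along the connected set S by the identity
theorem. The commutators are polynomial computations, and the gradation is read off from the degrees
of the basis fields. -/

/-- Schwarz reflection: φ and its conjugate reflection are holomorphic on the disc and agree at real
points accumulating at 0, hence everywhere. Radius 2 leaves room for the points ±i. -/
theorem eq_conj_of_real_on_real {φ : ℂ → ℂ} (hφ : DifferentiableOn ℂ φ (Metric.ball 0 2))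
    (hr : ∀ t : ℝ, |t| < 2 → (φ t).im = 0) : φ Complex.I = conj (φ (-Complex.I)) := by
  have hball : ∀ z : ℂ, z ∈ Metric.ball (0 : ℂ) 2 → conj z ∈ Metric.ball (0 : ℂ) 2 := by
    intro z hz
    simpa using hz
  have h1 : AnalyticOnNhd ℂ φ (Metric.ball 0 2) := hφ.analyticOnNhd Metric.isOpen_ball
  have h2 : AnalyticOnNhd ℂ (conj ∘ φ ∘ conj) (Metric.ball (0 : ℂ) 2) := by
    refine DifferentiableOn.analyticOnNhd (fun z hz => ?_) Metric.isOpen_ball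
    have h := (hφ _ (hball z hz)).differentiableAt (Metric.isOpen_ball.mem_nhds (hball z hz))
    have h' := h.conj_conj
    rw [Complex.conj_conj] at h'
    exact h'.differentiableWithinAt
  have hf : ∃ᶠ z in 𝓝[≠] (0 : ℂ), φ z = (conj ∘ φ ∘ conj) z := by
    have ht : Tendsto (fun t : ℝ => (t : ℂ)) (𝓝[≠] 0) (𝓝[≠] 0) := by
      refine tendsto_nhdsWithin_iff.2 ⟨?_, ?_⟩
      · exact (Complex.continuous_ofReal.tendsto' 0 0 (by simp)).mono_left nhdsWithin_le_nhds
      · filter_upwards [self_mem_nhdsWithin] with t ht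
        simpa using ht
    refine ht.frequently (Eventually.frequently ?_)
    have : ∀ᶠ t : ℝ in 𝓝[≠] 0, |t| < 2 := by
      refine nhdsWithin_le_nhds ?_
      filter_upwards [Metric.ball_mem_nhds (0 : ℝ) (by norm_num : (0 : ℝ) < 2)] with t ht
      simpa using ht
    filter_upwards [this] with t ht
    simp only [Function.comp_apply, Complex.conj_ofReal]
    exact (Complex.conj_eq_iff_im.2 (hr t ht)).symm
  have h := h1.eqOn_of_preconnected_of_frequently_eq h2 (Metric.isPreconnected_ball)
    (by simp) hf (show Complex.I ∈ Metric.ball (0 : ℂ) 2 by simp)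
  simpa using h

/-- The set {(z, z̄)} is totally real in ℂ². Every (z, ζ) is the point s = i of a complex line whose
real points lie in that set, and one-variable reflection applies on that line. -/
theorem eventually_eq_conj_of_real_on_antidiagonal {T : ℂ × ℂ → ℂ}
    (hT : ∀ᶠ p in 𝓝 (0 : ℂ × ℂ), DifferentiableAt ℂ T p)
    (hr : ∀ᶠ z in 𝓝 (0 : ℂ), (T (z, conj z)).im = 0) :
    ∀ᶠ p in 𝓝 (0 : ℂ × ℂ), T p = conj (T (conj p.2, conj p.1)) := by
  obtain ⟨ε, hε, h⟩ := Metric.eventually_nhds_iff_ball.1 hT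
  obtain ⟨δ, hδ, h'⟩ := Metric.eventually_nhds_iff_ball.1 hr
  have hpos : 0 < min ε δ / 3 := by positivity
  filter_upwards [Metric.ball_mem_nhds (0 : ℂ × ℂ) hpos] with p hp
  obtain ⟨z, ζ⟩ := p
  simp only [Metric.mem_ball, dist_zero_right, Prod.norm_mk, max_lt_iff] at hp
  obtain ⟨hz, hζ⟩ := hp
  -- α and β are chosen so that s ↦ (α + sβ, conj α + s conj β) passes through (z, ζ) at s = i and
  -- through (conj ζ, conj z) at s = -i, and stays on the antidiagonal for real s. The radius
  -- divided by 3 absorbs |s| < 2.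
  set α : ℂ := (z + conj ζ) / 2 with hα
  set β : ℂ := (z - conj ζ) / (2 * Complex.I) with hβ
  have nα : ‖α‖ < min ε δ / 3 := by
    rw [hα, norm_div]
    have := norm_add_le z (conj ζ)
    simp only [RCLike.norm_conj] at this
    simp only [Complex.norm_ofNat]
    linarith
  have nβ : ‖β‖ < min ε δ / 3 := by
    rw [hβ, norm_div]
    have := norm_sub_le z (conj ζ)
    simp only [RCLike.norm_conj] at this
    simp only [norm_mul, Complex.norm_ofNat, Complex.norm_I, mul_one]
    linarith
  have key : ∀ (s a b : ℂ), ‖s‖ < 2 → ‖a‖ < min ε δ / 3 → ‖b‖ < min ε δ / 3 →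
      ‖a + s * b‖ < min ε δ := by
    intro s a b hs ha hb
    have h1 := norm_add_le a (s * b)
    rw [norm_mul] at h1
    nlinarith [norm_nonneg s, norm_nonneg b]
  have hφ : DifferentiableOn ℂ (fun s : ℂ => T (α + s * β, conj α + s * conj β))
      (Metric.ball 0 2) := by
    intro s hs
    rw [mem_ball_zero_iff] at hs
    refine DifferentiableAt.differentiableWithinAt ?_
    have hm : (α + s * β, conj α + s * conj β) ∈ Metric.ball (0 : ℂ × ℂ) ε := by
      rw [mem_ball_zero_iff, Prod.norm_mk]
      refine (max_lt (key s α β hs nα nβ) (key s _ _ hs ?_ ?_)).trans_le (min_le_left _ _)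
      · simpa using nα
      · simpa using nβ
    exact (h _ hm).comp s (f := fun s : ℂ => (α + s * β, conj α + s * conj β)) (by fun_prop)
  have hre : ∀ t : ℝ, |t| < 2 → (T (α + (t : ℂ) * β, conj α + (t : ℂ) * conj β)).im = 0 := by
    intro t ht
    have := h' (α + (t : ℂ) * β) (by
      rw [mem_ball_zero_iff]
      exact (key t α β (by simpa using ht) nα nβ).trans_le (min_le_right _ _))
    simpa using this
  have e := eq_conj_of_real_on_real hφ hre
  have hcα : conj α = (conj z + ζ) / 2 := by simp [hα, Complex.conj_ofNat]
  have hcβ : conj β = -(conj z - ζ) / (2 * Complex.I) := by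
    simp [hβ, Complex.conj_ofNat]
    ring
  have e1 : α + Complex.I * β = z := by
    rw [hα, hβ]; field_simp; ring
  have e2 : conj α + Complex.I * conj β = ζ := by
    rw [hcα, hcβ]; field_simp; ring
  have e3 : α + -Complex.I * β = conj ζ := by
    rw [hα, hβ]; field_simp; ring
  have e4 : conj α + -Complex.I * conj β = conj z := by
    rw [hcα, hcβ]; field_simp; ring
  simpa only [e1, e2, e3, e4] using e

/-- The inclusion `ℝ⁸ ⊂ ℂ⁸`. -/
def realPoint (u : Fin 8 → ℝ) : Fin 8 → ℂ := fun j => (u j : ℂ)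

theorem continuous_realPoint : Continuous realPoint := by
  unfold realPoint
  fun_prop

theorem norm_realPoint (u : Fin 8 → ℝ) : ‖realPoint u‖ = ‖u‖ := by
  simp [realPoint, Pi.norm_def]

theorem realPoint_add_smul (u v : Fin 8 → ℝ) (t : ℝ) :
    realPoint u + (t : ℂ) • realPoint v = realPoint (u + t • v) := by
  funext j
  simp [realPoint]

/-- Reflection along the complex line s ↦ a + s v with a, v real, evaluated at s = ±i. -/
theorem eventually_eq_conj_of_real_on_real {f : (Fin 8 → ℂ) → ℂ} {u : Fin 8 → ℝ}
    (hf : ∀ᶠ w in 𝓝 (realPoint u), DifferentiableAt ℂ f w)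
    (hr : ∀ᶠ v in 𝓝 u, (f (realPoint v)).im = 0) :
    ∀ᶠ p : (Fin 8 → ℝ) × (Fin 8 → ℝ) in 𝓝 (u, 0),
      f (realPoint p.1 + Complex.I • realPoint p.2) =
      conj (f (realPoint p.1 - Complex.I • realPoint p.2)) := by
  obtain ⟨ε, hε, h⟩ := Metric.eventually_nhds_iff_ball.1 hf
  obtain ⟨δ, hδ, h'⟩ := Metric.eventually_nhds_iff_ball.1 hr
  have hpos : 0 < min ε δ / 3 := by positivity
  filter_upwards [Metric.ball_mem_nhds (u, (0 : Fin 8 → ℝ)) hpos] with p hp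
  obtain ⟨a, v⟩ := p
  rw [mem_ball_iff_norm, Prod.mk_sub_mk, Prod.norm_mk, sub_zero, max_lt_iff] at hp
  obtain ⟨ha, hv⟩ := hp
  have hφ : DifferentiableOn ℂ (fun s : ℂ => f (realPoint a + s • realPoint v))
      (Metric.ball 0 2) := by
    intro s hs
    rw [mem_ball_zero_iff] at hs
    refine DifferentiableAt.differentiableWithinAt ?_
    have hm : realPoint a + s • realPoint v ∈ Metric.ball (realPoint u) ε := by
      rw [mem_ball_iff_norm]
      have e : realPoint a + s • realPoint v - realPoint u
          = realPoint (a - u) + s • realPoint v := by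
        funext j
        simp [realPoint]
        ring
      rw [e]
      have h1 := norm_add_le (realPoint (a - u)) (s • realPoint v)
      rw [norm_smul, norm_realPoint, norm_realPoint] at h1
      have := min_le_left ε δ
      nlinarith [norm_nonneg s, norm_nonneg v]
    exact (h _ hm).comp s (f := fun s : ℂ => realPoint a + s • realPoint v) (by fun_prop)
  have hre : ∀ t : ℝ, |t| < 2 → (f (realPoint a + (t : ℂ) • realPoint v)).im = 0 := by
    intro t ht
    rw [realPoint_add_smul]
    refine h' _ ?_
    rw [mem_ball_iff_norm]
    have e : a + t • v - u = (a - u) + t • v := by abel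
    rw [e]
    have h1 := norm_add_le (a - u) (t • v)
    rw [norm_smul, Real.norm_eq_abs] at h1
    have := min_le_right ε δ
    nlinarith [abs_nonneg t, norm_nonneg v]
  have e := eq_conj_of_real_on_real hφ hre
  simpa only [neg_smul, ← sub_eq_add_neg] using e

theorem eventually_eq_zero_of_eq_zero_on_real {f : (Fin 8 → ℂ) → ℂ} {u : Fin 8 → ℝ} {ε : ℝ}
    (hf : ∀ w ∈ Metric.ball (realPoint u) ε, DifferentiableAt ℂ f w)
    (hr : ∀ v ∈ Metric.ball u ε, f (realPoint v) = 0) :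
    ∀ w ∈ Metric.ball (realPoint u) (ε / 3), f w = 0 := by
  intro w hw
  rw [mem_ball_iff_norm] at hw
  set a : Fin 8 → ℝ := fun j => (w j).re with ha
  set v : Fin 8 → ℝ := fun j => (w j).im with hv
  have hpos : 0 < ε / 3 := (norm_nonneg _).trans_lt hw
  have hwj : ∀ j, ‖w j - u j‖ < ε / 3 := fun j => (norm_le_pi_norm (w - realPoint u) j).trans_lt hw
  have na : ‖a - u‖ < ε / 3 := by
    refine (pi_norm_lt_iff hpos).2 fun j => lt_of_le_of_lt ?_ (hwj j)
    simpa [ha] using Complex.abs_re_le_norm (w j - u j)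
  have nv : ‖v‖ < ε / 3 := by
    refine (pi_norm_lt_iff hpos).2 fun j => lt_of_le_of_lt ?_ (hwj j)
    simpa [hv] using Complex.abs_im_le_norm (w j - u j)
  have hφ : DifferentiableOn ℂ (fun s : ℂ => f (realPoint a + s • realPoint v))
      (Metric.ball 0 2) := by
    intro s hs
    rw [mem_ball_zero_iff] at hs
    refine DifferentiableAt.differentiableWithinAt ?_
    have hm : realPoint a + s • realPoint v ∈ Metric.ball (realPoint u) ε := by
      rw [mem_ball_iff_norm]
      have e : realPoint a + s • realPoint v - realPoint u
          = realPoint (a - u) + s • realPoint v := by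
        funext j
        simp [realPoint]
        ring
      rw [e]
      have h1 := norm_add_le (realPoint (a - u)) (s • realPoint v)
      rw [norm_smul, norm_realPoint, norm_realPoint] at h1
      nlinarith [norm_nonneg s, norm_nonneg v]
    exact (hf _ hm).comp s (f := fun s : ℂ => realPoint a + s • realPoint v) (by fun_prop)
  have hre : ∀ t : ℝ, |t| < 2 → f (realPoint a + (t : ℂ) • realPoint v) = 0 := by
    intro t ht
    rw [realPoint_add_smul]
    refine hr _ ?_
    rw [mem_ball_iff_norm]
    have e : a + t • v - u = (a - u) + t • v := by abel
    rw [e]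
    have h1 := norm_add_le (a - u) (t • v)
    rw [norm_smul, Real.norm_eq_abs] at h1
    nlinarith [abs_nonneg t, norm_nonneg v]
  -- Both f and i·f are real, being zero, on the real points of the line. Reflection of each gives i
  -- f(w) = -i f(w), hence f(w) = 0.
  have e1 := eq_conj_of_real_on_real hφ fun t ht => by rw [hre t ht]; simp
  have e2 := eq_conj_of_real_on_real (hφ.const_mul Complex.I) fun t ht => by
    rw [hre t ht]; simp
  have hw' : realPoint a + Complex.I • realPoint v = w := by
    funext j
    simp [realPoint, ha, hv, mul_comm Complex.I, Complex.re_add_im]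
  simp only [hw'] at e1 e2
  rw [map_mul, ← e1, Complex.conj_I] at e2
  have h2 : (2 * Complex.I) * f w = 0 := by linear_combination e2
  simpa using h2

/-- A holomorphic function vanishing at the points `(z, v)` with `v` real vanishes. -/
theorem eventually_eq_zero_of_real_slices {h : C9 → ℂ} {u : Fin 8 → ℝ}
    (hh : AnalyticAt ℂ h (0, realPoint u))
    (h0 : ∀ᶠ v in 𝓝 u, ∀ᶠ z in 𝓝 (0 : ℂ), h (z, realPoint v) = 0) :
    ∀ᶠ q in 𝓝 ((0, realPoint u) : C9), h q = 0 := by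
  obtain ⟨ε, hε, ha⟩ := Metric.eventually_nhds_iff_ball.1 hh.eventually_analyticAt
  obtain ⟨δ, hδ, h'⟩ := Metric.eventually_nhds_iff_ball.1 h0
  have hpos : 0 < min ε δ := lt_min hε hδ
  have hmem : ∀ z w, ‖z‖ < ε → w ∈ Metric.ball (realPoint u) ε →
      ((z, w) : C9) ∈ Metric.ball ((0, realPoint u) : C9) ε := by
    intro z w hz hw
    rw [← ball_prod_same]
    exact ⟨by simpa using hz, hw⟩
  -- The neighbourhood of z = 0 given by `h0` may depend on v; the identity theorem in z replaces it
  -- by a disc of fixed radius.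
  have hz0 : ∀ z ∈ Metric.ball (0 : ℂ) ε, ∀ v ∈ Metric.ball u (min ε δ),
      h (z, realPoint v) = 0 := by
    intro z hz v hv
    have hvε : realPoint v ∈ Metric.ball (realPoint u) ε := by
      rw [mem_ball_iff_norm] at hv ⊢
      have : realPoint v - realPoint u = realPoint (v - u) := by
        funext j; simp [realPoint]
      rw [this, norm_realPoint]
      exact hv.trans_le (min_le_left _ _)
    have han : AnalyticOnNhd ℂ (fun z : ℂ => h (z, realPoint v)) (Metric.ball 0 ε) := by
      intro y hy
      exact AnalyticAt.fun_comp (g := h) (f := fun z : ℂ => ((z, realPoint v) : C9))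
        (ha (y, realPoint v) (hmem y _ (by simpa using hy) hvε))
        (AnalyticAt.prod analyticAt_id analyticAt_const)
    exact han.eqOn_zero_of_preconnected_of_eventuallyEq_zero Metric.isPreconnected_ball
      (Metric.mem_ball_self hε) (h' v (Metric.ball_subset_ball (min_le_right _ _) hv)) hz
  have hpos3 : 0 < min ε δ / 3 := by positivity
  filter_upwards [Metric.ball_mem_nhds ((0, realPoint u) : C9) hpos3] with q hq
  obtain ⟨z, w⟩ := q
  rw [← ball_prod_same] at hq
  obtain ⟨hz, hw⟩ := hq
  have hzε : z ∈ Metric.ball (0 : ℂ) ε := by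
    refine Metric.ball_subset_ball ?_ hz
    have := min_le_left ε δ
    linarith
  refine eventually_eq_zero_of_eq_zero_on_real (f := fun w => h (z, w)) (u := u) (ε := min ε δ)
    (fun y hy => ?_) (fun v hv => hz0 z hzε v hv) w hw
  exact ((ha (z, y) (hmem z y (by simpa using hzε)
    (Metric.ball_subset_ball (min_le_left _ _) hy))).differentiableAt).comp y
    (f := fun y : Fin 8 → ℂ => ((z, y) : C9)) (by fun_prop)

/-! ### Polarization of the defining functions -/

/-- The polarization of `Xi`, in which `conj z` becomes an independent variable `ζ`. -/
noncomputable def XiC (z ζ : ℂ) : Fin 8 → ℂ :=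
  ![2 * Complex.I * (z * ζ),
    2 * Complex.I * (z ^ 2 * ζ + z * ζ ^ 2),
    2 * (z ^ 2 * ζ - z * ζ ^ 2),
    2 * Complex.I * (z ^ 3 * ζ + z * ζ ^ 3),
    2 * (z ^ 3 * ζ - z * ζ ^ 3),
    2 * Complex.I * (z ^ 2 * ζ ^ 2),
    2 * Complex.I * (z ^ 4 * ζ + z * ζ ^ 4),
    2 * (z ^ 4 * ζ - z * ζ ^ 4)]

/-- The derivative of `XiC` in its first variable. -/
noncomputable def XiZ (z ζ : ℂ) : Fin 8 → ℂ :=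
  ![2 * Complex.I * ζ,
    2 * Complex.I * (2 * z * ζ + ζ ^ 2),
    2 * (2 * z * ζ - ζ ^ 2),
    2 * Complex.I * (3 * z ^ 2 * ζ + ζ ^ 3),
    2 * (3 * z ^ 2 * ζ - ζ ^ 3),
    2 * Complex.I * (2 * z * ζ ^ 2),
    2 * Complex.I * (4 * z ^ 3 * ζ + ζ ^ 4),
    2 * (4 * z ^ 3 * ζ - ζ ^ 4)]

/-- The value at `ζ = 0` of the derivative of `XiC` in its second variable. -/
noncomputable def linXi (z : ℂ) : Fin 8 → ℂ :=
  ![2 * Complex.I * z, 2 * Complex.I * z ^ 2, 2 * z ^ 2, 2 * Complex.I * z ^ 3, 2 * z ^ 3, 0,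
    2 * Complex.I * z ^ 4, 2 * z ^ 4]

/-- The derivative of `linXi`. -/
noncomputable def dlinXi (z : ℂ) : Fin 8 → ℂ :=
  ![2 * Complex.I, 4 * Complex.I * z, 4 * z, 6 * Complex.I * z ^ 2, 6 * z ^ 2, 0,
    8 * Complex.I * z ^ 3, 8 * z ^ 3]

/-- The value at `ζ = 0` of the second derivative of `XiC` in its second variable. -/
noncomputable def quadXi (z : ℂ) : Fin 8 → ℂ :=
  ![0, 4 * Complex.I * z, -4 * z, 0, 0, 4 * Complex.I * z ^ 2, 0, 0]

theorem conj_XiC (z ζ : ℂ) (l : Fin 8) : conj (XiC z ζ l) = -XiC (conj ζ) (conj z) l := by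
  fin_cases l <;> simp [XiC, Complex.conj_ofNat] <;> ring

theorem XiC_conj (z : ℂ) : XiC z (conj z) = Xi z := rfl

theorem XiC_zero_right (z : ℂ) : XiC z 0 = 0 := by
  funext l
  fin_cases l <;> simp [XiC]

theorem XiC_zero_left (ζ : ℂ) : XiC 0 ζ = 0 := by
  funext l
  fin_cases l <;> simp [XiC]

theorem XiZ_zero_right (z : ℂ) : XiZ z 0 = 0 := by
  funext l
  fin_cases l <;> simp [XiZ]

theorem conj_XiZ_zero_conj (z : ℂ) (l : Fin 8) : conj (XiZ 0 (conj z) l) = -linXi z l := by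
  fin_cases l <;> simp [XiZ, linXi, Complex.conj_ofNat]

section

variable {𝕜 : Type*} [NontriviallyNormedField 𝕜] [NormedAlgebra 𝕜 ℂ]

theorem hasDerivAt_monomial {a b : 𝕜 → ℂ} {a' b' : ℂ} {t : 𝕜} (ha : HasDerivAt a a' t)
    (hb : HasDerivAt b b' t) (m n : ℕ) : HasDerivAt (fun s => a s ^ m * b s ^ n)
      ((m * a t ^ (m - 1) * a') * b t ^ n + a t ^ m * (n * b t ^ (n - 1) * b')) t :=
  (ha.fun_pow m).fun_mul (hb.fun_pow n)

/-- By the symmetry `conj_XiC`, the derivative in ζ is minus the conjugate reflection of the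
derivative in z, so `XiZ` suffices. The field 𝕜 is ℝ for the tangency condition and ℂ for the
polarized functions. -/
theorem hasDerivAt_XiC {a b : 𝕜 → ℂ} {a' b' : ℂ} {t : 𝕜} (ha : HasDerivAt a a' t)
    (hb : HasDerivAt b b' t) (l : Fin 8) : HasDerivAt (fun s => XiC (a s) (b s) l)
      (XiZ (a t) (b t) l * a' - conj (XiZ (conj (b t)) (conj (a t)) l) * b') t := by
  have h := hasDerivAt_monomial ha hb
  fin_cases l
  · refine ((((h 1 1).const_mul (2 * Complex.I))).congr_deriv ?_).congr_of_eventuallyEq (.of_forall fun _ => ?_)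
    · simp [XiZ, Complex.conj_ofNat]; ring
    · simp [XiC]
  · refine (((((h 2 1).add (h 1 2)).const_mul (2 * Complex.I))).congr_deriv ?_).congr_of_eventuallyEq (.of_forall fun _ => ?_)
    · simp [XiZ, Complex.conj_ofNat]; ring
    · simp [XiC]
  · refine (((((h 2 1).sub (h 1 2)).const_mul 2)).congr_deriv ?_).congr_of_eventuallyEq (.of_forall fun _ => ?_)
    · simp [XiZ, Complex.conj_ofNat]; ring
    · simp [XiC]
  · refine (((((h 3 1).add (h 1 3)).const_mul (2 * Complex.I))).congr_deriv ?_).congr_of_eventuallyEq (.of_forall fun _ => ?_)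
    · simp [XiZ, Complex.conj_ofNat]; ring
    · simp [XiC]
  · refine (((((h 3 1).sub (h 1 3)).const_mul 2)).congr_deriv ?_).congr_of_eventuallyEq (.of_forall fun _ => ?_)
    · simp [XiZ, Complex.conj_ofNat]; ring
    · simp [XiC]
  · refine ((((h 2 2).const_mul (2 * Complex.I))).congr_deriv ?_).congr_of_eventuallyEq (.of_forall fun _ => ?_)
    · simp [XiZ, Complex.conj_ofNat]; ring
    · simp [XiC]
  · refine (((((h 4 1).add (h 1 4)).const_mul (2 * Complex.I))).congr_deriv ?_).congr_of_eventuallyEq (.of_forall fun _ => ?_)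
    · simp [XiZ, Complex.conj_ofNat]; ring
    · simp [XiC]
  · refine (((((h 4 1).sub (h 1 4)).const_mul 2)).congr_deriv ?_).congr_of_eventuallyEq (.of_forall fun _ => ?_)
    · simp [XiZ, Complex.conj_ofNat]; ring
    · simp [XiC]

end

/-- This is the mixed derivative of `XiC` at ζ = 0, so it agrees with the z-derivative of `linXi`.
-/
theorem hasDerivAt_XiZ_right (z : ℂ) (l : Fin 8) :
    HasDerivAt (fun ζ => XiZ z ζ l) (dlinXi z l) 0 := by
  have h := hasDerivAt_monomial (hasDerivAt_const (0 : ℂ) z) (hasDerivAt_id (0 : ℂ))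
  fin_cases l
  · refine ((((h 0 1).const_mul (2 * Complex.I))).congr_deriv ?_).congr_of_eventuallyEq (.of_forall fun _ => ?_)
    · simp [dlinXi]
    · simp [XiZ]
  · refine ((((((h 1 1).const_mul 2).add (h 0 2)).const_mul (2 * Complex.I))).congr_deriv ?_).congr_of_eventuallyEq (.of_forall fun _ => ?_)
    · simp [dlinXi]; ring
    · simp [XiZ]; ring
  · refine ((((((h 1 1).const_mul 2).sub (h 0 2)).const_mul 2)).congr_deriv ?_).congr_of_eventuallyEq (.of_forall fun _ => ?_)
    · simp [dlinXi]; ring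
    · simp [XiZ]; ring
  · refine ((((((h 2 1).const_mul 3).add (h 0 3)).const_mul (2 * Complex.I))).congr_deriv ?_).congr_of_eventuallyEq (.of_forall fun _ => ?_)
    · simp [dlinXi]; ring
    · simp [XiZ]; ring
  · refine ((((((h 2 1).const_mul 3).sub (h 0 3)).const_mul 2)).congr_deriv ?_).congr_of_eventuallyEq (.of_forall fun _ => ?_)
    · simp [dlinXi]; ring
    · simp [XiZ]; ring
  · refine ((((h 1 2).const_mul (4 * Complex.I))).congr_deriv ?_).congr_of_eventuallyEq (.of_forall fun _ => ?_)
    · simp [dlinXi]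
    · simp [XiZ]; ring
  · refine ((((((h 3 1).const_mul 4).add (h 0 4)).const_mul (2 * Complex.I))).congr_deriv ?_).congr_of_eventuallyEq (.of_forall fun _ => ?_)
    · simp [dlinXi]; ring
    · simp [XiZ]; ring
  · refine ((((((h 3 1).const_mul 4).sub (h 0 4)).const_mul 2)).congr_deriv ?_).congr_of_eventuallyEq (.of_forall fun _ => ?_)
    · simp [dlinXi]; ring
    · simp [XiZ]; ring

/-- The second z-derivative of `XiC` at z = 0 is, by the conjugation symmetry, minus the conjugate
of the second ζ-derivative at ζ = 0. -/
theorem hasDerivAt_XiZ_left (z : ℂ) (l : Fin 8) :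
    HasDerivAt (fun y => XiZ y (conj z) l) (-conj (quadXi z l)) 0 := by
  have h := hasDerivAt_monomial (hasDerivAt_id (0 : ℂ)) (hasDerivAt_const (0 : ℂ) (conj z))
  fin_cases l
  · refine ((((h 0 1).const_mul (2 * Complex.I))).congr_deriv ?_).congr_of_eventuallyEq (.of_forall fun _ => ?_)
    · simp [quadXi]
    · simp [XiZ]
  · refine ((((((h 1 1).const_mul 2).add (h 0 2)).const_mul (2 * Complex.I))).congr_deriv ?_).congr_of_eventuallyEq (.of_forall fun _ => ?_)
    · simp [quadXi, Complex.conj_ofNat]; ring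
    · simp [XiZ]; ring
  · refine ((((((h 1 1).const_mul 2).sub (h 0 2)).const_mul 2)).congr_deriv ?_).congr_of_eventuallyEq (.of_forall fun _ => ?_)
    · simp [quadXi, Complex.conj_ofNat]; ring
    · simp [XiZ]; ring
  · refine ((((((h 2 1).const_mul 3).add (h 0 3)).const_mul (2 * Complex.I))).congr_deriv ?_).congr_of_eventuallyEq (.of_forall fun _ => ?_)
    · simp [quadXi]
    · simp [XiZ]; ring
  · refine ((((((h 2 1).const_mul 3).sub (h 0 3)).const_mul 2)).congr_deriv ?_).congr_of_eventuallyEq (.of_forall fun _ => ?_)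
    · simp [quadXi]
    · simp [XiZ]; ring
  · refine ((((h 1 2).const_mul (4 * Complex.I))).congr_deriv ?_).congr_of_eventuallyEq (.of_forall fun _ => ?_)
    · simp [quadXi, Complex.conj_ofNat]
    · simp [XiZ]; ring
  · refine ((((((h 3 1).const_mul 4).add (h 0 4)).const_mul (2 * Complex.I))).congr_deriv ?_).congr_of_eventuallyEq (.of_forall fun _ => ?_)
    · simp [quadXi]
    · simp [XiZ]; ring
  · refine ((((((h 3 1).const_mul 4).sub (h 0 4)).const_mul 2)).congr_deriv ?_).congr_of_eventuallyEq (.of_forall fun _ => ?_)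
    · simp [quadXi]
    · simp [XiZ]; ring

theorem hasDerivAt_linXi (l : Fin 8) : HasDerivAt (fun z => linXi z l) (dlinXi 0 l) 0 := by
  have h : ∀ (c : ℂ) (m : ℕ), HasDerivAt (fun z : ℂ => c * z ^ m) (c * (m * 0 ^ (m - 1))) 0 :=
    fun c m => (hasDerivAt_pow m (0 : ℂ)).const_mul c
  fin_cases l
  · refine ((h (2 * Complex.I) 1).congr_deriv ?_).congr_of_eventuallyEq (.of_forall fun _ => ?_) <;>
      simp [linXi, dlinXi]
  · refine ((h (2 * Complex.I) 2).congr_deriv ?_).congr_of_eventuallyEq (.of_forall fun _ => ?_) <;>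
      simp [linXi, dlinXi]
  · refine ((h 2 2).congr_deriv ?_).congr_of_eventuallyEq (.of_forall fun _ => ?_) <;>
      simp [linXi, dlinXi]
  · refine ((h (2 * Complex.I) 3).congr_deriv ?_).congr_of_eventuallyEq (.of_forall fun _ => ?_) <;>
      simp [linXi, dlinXi]
  · refine ((h 2 3).congr_deriv ?_).congr_of_eventuallyEq (.of_forall fun _ => ?_) <;>
      simp [linXi, dlinXi]
  · refine ((h 0 1).congr_deriv ?_).congr_of_eventuallyEq (.of_forall fun _ => ?_) <;>
      simp [linXi, dlinXi]
  · refine ((h (2 * Complex.I) 4).congr_deriv ?_).congr_of_eventuallyEq (.of_forall fun _ => ?_) <;>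
      simp [linXi, dlinXi]
  · refine ((h 2 4).congr_deriv ?_).congr_of_eventuallyEq (.of_forall fun _ => ?_) <;>
      simp [linXi, dlinXi]

/-! ### Tangency in terms of holomorphic data -/

/-- Differentiate along the real line q + t v. The defining function is purely imaginary, so its
differential is a quantity minus its conjugate, and tangency becomes the reality of W^l − Ξ^l_z Z.
-/
theorem fderiv_rho_apply (l : Fin 8) (q v : C9) : fderiv ℝ (rho l) q v =
    (v.2 l - XiZ q.1 (conj q.1) l * v.1) - conj (v.2 l - XiZ q.1 (conj q.1) l * v.1) := by
  have hd : HasFDerivAt (rho l) (fderiv ℝ (rho l) q) q :=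
    ((contDiff_rho l).differentiable (by simp) q).hasFDerivAt
  have hline : HasDerivAt (fun t : ℝ => q + t • v) v 0 := by
    have h := ((hasDerivAt_id (0 : ℝ)).smul_const v).const_add q
    rw [one_smul] at h
    exact h
  have h1 : HasDerivAt (fun t : ℝ => rho l (q + t • v)) (fderiv ℝ (rho l) q v) 0 := by
    have hd' : HasFDerivAt (rho l) (fderiv ℝ (rho l) q) (q + (0 : ℝ) • v) := by
      rw [zero_smul, add_zero]
      exact hd
    exact hd'.comp_hasDerivAt (0 : ℝ) hline
  have hz : HasDerivAt (fun t : ℝ => (q + t • v).1) v.1 0 := hline.fst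
  have hw : HasDerivAt (fun t : ℝ => (q + t • v).2 l) (v.2 l) 0 :=
    (hasDerivAt_pi.1 hline.snd) l
  have hzc : HasDerivAt (fun t : ℝ => conj ((q + t • v).1)) (conj v.1) 0 := hz.star
  have hwc : HasDerivAt (fun t : ℝ => conj ((q + t • v).2 l)) (conj (v.2 l)) 0 := hw.star
  have h2 := (hw.sub hwc).sub (hasDerivAt_XiC hz hzc l)
  have h3 := h1.unique h2
  rw [h3]
  simp only [zero_smul, add_zero, Complex.conj_conj, map_sub, map_mul]
  ring

theorem isTangentAt_iff (X : C9 → C9) (q : C9) : IsTangentAt X q ↔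
    ∀ l, ((X q).2 l - XiZ q.1 (conj q.1) l * (X q).1).im = 0 := by
  refine forall_congr' fun l => ?_
  rw [fderiv_rho_apply, sub_eq_zero, eq_comm, Complex.conj_eq_iff_im]

/-- The parametrization of `𝕄¹` by `ℂ × ℝ⁸`, polarized. -/
noncomputable def polarPoint (u : Fin 8 → ℝ) (p : ℂ × ℂ) : C9 :=
  (p.1, realPoint u + (1 / 2 : ℂ) • XiC p.1 p.2)

theorem polarPoint_zero_right (u : Fin 8 → ℝ) (z : ℂ) :
    polarPoint u (z, 0) = (z, realPoint u) := by
  simp [polarPoint, XiC_zero_right]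

theorem polarPoint_zero_left (u : Fin 8 → ℝ) (ζ : ℂ) :
    polarPoint u (0, ζ) = (0, realPoint u) := by
  simp [polarPoint, XiC_zero_left]

theorem polarPoint_conj_mem (u : Fin 8 → ℝ) (z : ℂ) : polarPoint u (z, conj z) ∈ M1 := by
  intro j
  have h := conj_XiC z (conj z) j
  rw [Complex.conj_conj, XiC_conj] at h
  simp only [rho, polarPoint, realPoint, Pi.add_apply, Pi.smul_apply, smul_eq_mul, map_add,
    map_mul, map_div₀, map_one, Complex.conj_ofReal, XiC_conj, h, Complex.conj_ofNat]
  ring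

theorem contDiff_XiC : ContDiff ℂ 1 fun p : ℂ × ℂ => XiC p.1 p.2 := by
  refine contDiff_pi.2 fun l => ?_
  fin_cases l <;> simp [XiC] <;> fun_prop

theorem contDiff_XiZ (l : Fin 8) : ContDiff ℂ 1 fun p : ℂ × ℂ => XiZ p.1 p.2 l := by
  fin_cases l <;> simp [XiZ] <;> fun_prop

theorem contDiff_polarPoint (u : Fin 8 → ℝ) : ContDiff ℂ 1 (polarPoint u) :=
  contDiff_fst.prodMk (contDiff_const.add (contDiff_XiC.const_smul _))

theorem tendsto_polarPoint (u : Fin 8 → ℝ) :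
    Tendsto (polarPoint u) (𝓝 0) (𝓝 (0, realPoint u)) :=
  (contDiff_polarPoint u).continuous.tendsto' _ _ (polarPoint_zero_right u 0)

/-- A vector field that is holomorphic near the point `(0, u)` of `𝕄¹` and tangent to `𝕄¹`
near it. -/
structure IsAutNear (X : C9 → C9) (u : Fin 8 → ℝ) : Prop where
  analyticAt : AnalyticAt ℂ X (0, realPoint u)
  tangent : ∀ᶠ q in 𝓝 ((0, realPoint u) : C9), q ∈ M1 → IsTangentAt X q

/-- The holomorphic function `W^l - Ξ^l_z Z` on the polarized model. -/
noncomputable def polarCoeff (X : C9 → C9) (u : Fin 8 → ℝ) (l : Fin 8) (p : ℂ × ℂ) : ℂ :=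
  (X (polarPoint u p)).2 l - XiZ p.1 p.2 l * (X (polarPoint u p)).1

/-- The derivative of a vector field in the direction `w^j`. -/
noncomputable def dW (j : Fin 8) (X : C9 → C9) (q : C9) : C9 :=
  fderiv ℂ X q (0, Pi.single j 1)

theorem fderiv_snd_eq_sum (X : C9 → C9) (q : C9) (v : Fin 8 → ℂ) :
    fderiv ℂ X q (0, v) = ∑ j, v j • dW j X q := by
  have h : ((0, v) : C9) = ∑ j, v j • ((0, Pi.single j 1) : C9) := by
    refine Prod.ext ?_ ?_
    · simp [Prod.fst_sum]
    · simp only [Prod.snd_sum, Prod.smul_snd]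
      rw [← pi_eq_sum_univ' v]
  rw [h, map_sum]
  exact Finset.sum_congr rfl fun j _ => map_smul _ _ _

/-! ### The reflected tangency identity to orders zero and one in ζ. -/

namespace IsAutNear

variable {X : C9 → C9} {u : Fin 8 → ℝ}

theorem eventually (hX : IsAutNear X u) : ∀ᶠ v in 𝓝 u, IsAutNear X v := by
  have ht : Tendsto (fun v : Fin 8 → ℝ => ((0, realPoint v) : C9)) (𝓝 u)
      (𝓝 (0, realPoint u)) :=
    (continuous_const.prodMk continuous_realPoint).tendsto u
  filter_upwards [ht.eventually hX.analyticAt.eventually_analyticAt,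
    ht.eventually hX.tangent.eventually_nhds] with v h1 h2
  exact ⟨h1, h2⟩

/-- The constant field ∂_j is tangent because 𝕄¹ is rigid, and its bracket with X is the derivative
of X. Every relation found for X therefore also holds for its w-derivatives. -/
theorem dW (hX : IsAutNear X u) (j : Fin 8) : IsAutNear (dW j X) u := by
  have hb : VectorField.lieBracket ℂ (fun _ => ((0, Pi.single j 1) : C9)) X = _root_.dW j X := by
    funext q
    simp [VectorField.lieBracket, _root_.dW]
  have hc : ∀ q, IsTangentAt (fun _ => ((0, Pi.single j 1) : C9)) q := by
    intro q
    rw [isTangentAt_iff]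
    intro l
    by_cases h : l = j
    · subst h; simp
    · simp [h]
  refine ⟨?_, ?_⟩
  · rw [← hb]
    exact analyticOnNhd_lieBracket (S := {(0, realPoint u)}) (fun _ _ => analyticAt_const)
      (by rintro _ rfl; exact hX.analyticAt) _ rfl
  · rw [← hb]
    filter_upwards [hX.analyticAt.eventually_analyticAt, hX.tangent.eventually_nhds]
      with q h1 h2 hq
    exact isTangentAt_lieBracket hq analyticAt_const h1
      (Eventually.of_forall fun p _ => hc p) h2

theorem polarCoeff_eq_conj (hX : IsAutNear X u) (l : Fin 8) : ∀ᶠ p in 𝓝 (0 : ℂ × ℂ),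
    polarCoeff X u l p = conj (polarCoeff X u l (conj p.2, conj p.1)) := by
  refine eventually_eq_conj_of_real_on_antidiagonal ?_ ?_
  · filter_upwards [(tendsto_polarPoint u).eventually hX.analyticAt.eventually_analyticAt]
      with p hp
    have h1 : DifferentiableAt ℂ (fun p => X (polarPoint u p)) p :=
      hp.differentiableAt.comp p ((contDiff_polarPoint u).differentiable (by simp) p)
    have h2 : DifferentiableAt ℂ (fun p => (X (polarPoint u p)).2 l) p :=
      (differentiableAt_pi.1 h1.snd) l
    exact h2.sub (((contDiff_XiZ l).differentiable (by simp) p).mul h1.fst)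
  · have ht : Tendsto (fun z : ℂ => polarPoint u (z, conj z)) (𝓝 0) (𝓝 (0, realPoint u)) := by
      refine (tendsto_polarPoint u).comp ?_
      refine Continuous.tendsto' ?_ _ _ (by simp)
      exact continuous_id.prodMk Complex.continuous_conj
    filter_upwards [ht.eventually hX.tangent] with z hz
    exact (isTangentAt_iff _ _).1 (hz (polarPoint_conj_mem u z)) l

theorem snd_im_eq_zero (hX : IsAutNear X u) (l : Fin 8) :
    ((X (0, realPoint u)).2 l).im = 0 := by
  have h := (hX.polarCoeff_eq_conj l).self_of_nhds
  rw [← Complex.conj_eq_iff_im]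
  simpa [polarCoeff, polarPoint_zero_right, ← Prod.mk_zero_zero, XiZ_zero_right] using h.symm

/-- Put ζ = 0 in the reflection identity: Ξ vanishes when either variable does, so both sides are
evaluated over the same real u, and Ξ_z survives only on the conjugate side. -/
theorem snd_eq (hX : IsAutNear X u) (l : Fin 8) : ∀ᶠ z in 𝓝 (0 : ℂ),
    (X (z, realPoint u)).2 l =
      (X (0, realPoint u)).2 l + linXi z l * conj (X (0, realPoint u)).1 := by
  have ht : Tendsto (fun z : ℂ => (z, (0 : ℂ))) (𝓝 0) (𝓝 0) :=
    Continuous.tendsto' (by fun_prop) _ _ rfl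
  filter_upwards [ht.eventually (hX.polarCoeff_eq_conj l)] with z hz
  have hr := Complex.conj_eq_iff_im.2 (hX.snd_im_eq_zero l)
  simp only [polarCoeff, polarPoint_zero_right, polarPoint_zero_left, map_zero, XiZ_zero_right,
    Pi.zero_apply, zero_mul, sub_zero, map_sub, map_mul, conj_XiZ_zero_conj, hr] at hz
  rw [hz]
  ring

theorem fderiv_fst_snd (hX : IsAutNear X u) (l : Fin 8) :
    (fderiv ℂ X (0, realPoint u) (1, 0)).2 l = dlinXi 0 l * conj (X (0, realPoint u)).1 := by
  have h1 : HasDerivAt (fun z : ℂ => X (z, realPoint u)) (fderiv ℂ X (0, realPoint u) (1, 0)) 0 :=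
    HasFDerivAt.comp_hasDerivAt (f := fun z : ℂ => ((z, realPoint u) : C9)) (0 : ℂ)
      hX.analyticAt.differentiableAt.hasFDerivAt
      ((hasDerivAt_id (0 : ℂ)).prodMk (hasDerivAt_const _ _))
  have h2 : HasDerivAt (fun z : ℂ => (X (z, realPoint u)).2 l) _ 0 := (hasDerivAt_pi.1 h1.snd) l
  have h3 := ((hasDerivAt_linXi l).mul_const (conj (X (0, realPoint u)).1)).const_add
    ((X (0, realPoint u)).2 l)
  exact h2.unique (h3.congr_of_eventuallyEq (hX.snd_eq l))

theorem hasDerivAt_polarCoeff_right {z : ℂ} (hd : DifferentiableAt ℂ X (z, realPoint u))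
    (l : Fin 8) : HasDerivAt (fun ζ => polarCoeff X u l (z, ζ))
      ((fderiv ℂ X (z, realPoint u) (0, (1 / 2 : ℂ) • linXi z)).2 l -
        dlinXi z l * (X (z, realPoint u)).1) 0 := by
  have hc : HasDerivAt (fun ζ : ℂ => polarPoint u (z, ζ)) (0, (1 / 2 : ℂ) • linXi z) 0 := by
    refine (hasDerivAt_const _ _).prodMk (HasDerivAt.const_add _ (HasDerivAt.fun_const_smul _ ?_))
    refine hasDerivAt_pi.2 fun k => ?_
    have h := hasDerivAt_XiC (hasDerivAt_const (0 : ℂ) z) (hasDerivAt_id (0 : ℂ)) k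
    simpa [conj_XiZ_zero_conj] using h
  have h1 : HasDerivAt (fun ζ : ℂ => X (polarPoint u (z, ζ)))
      (fderiv ℂ X (z, realPoint u) (0, (1 / 2 : ℂ) • linXi z)) 0 := by
    refine HasFDerivAt.comp_hasDerivAt (0 : ℂ) ?_ hc
    rw [polarPoint_zero_right]
    exact hd.hasFDerivAt
  have h2 := ((hasDerivAt_pi.1 h1.snd) l).sub ((hasDerivAt_XiZ_right z l).mul h1.fst)
  refine h2.congr_deriv ?_
  simp [polarPoint_zero_right, XiZ_zero_right]

/-- With y = ζ̄, this is the derivative needed for the conjugated side of the reflection identity;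
`hasDerivAt_polarCoeff_right` treats the other side. -/
theorem hasDerivAt_polarCoeff_left (hX : IsAutNear X u) (z : ℂ) (l : Fin 8) :
    HasDerivAt (fun y => polarCoeff X u l (y, conj z))
      ((fderiv ℂ X (0, realPoint u) (1, (1 / 2 : ℂ) • XiZ 0 (conj z))).2 l -
        (-conj (quadXi z l) * (X (0, realPoint u)).1 +
          XiZ 0 (conj z) l *
            (fderiv ℂ X (0, realPoint u) (1, (1 / 2 : ℂ) • XiZ 0 (conj z))).1)) 0 := by
  have hc : HasDerivAt (fun y : ℂ => polarPoint u (y, conj z))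
      (1, (1 / 2 : ℂ) • XiZ 0 (conj z)) 0 := by
    refine (hasDerivAt_id _).prodMk (HasDerivAt.const_add _ (HasDerivAt.fun_const_smul _ ?_))
    refine hasDerivAt_pi.2 fun k => ?_
    have h := hasDerivAt_XiC (hasDerivAt_id (0 : ℂ)) (hasDerivAt_const (0 : ℂ) (conj z)) k
    simpa using h
  have h1 : HasDerivAt (fun y : ℂ => X (polarPoint u (y, conj z)))
      (fderiv ℂ X (0, realPoint u) (1, (1 / 2 : ℂ) • XiZ 0 (conj z))) 0 := by
    refine HasFDerivAt.comp_hasDerivAt (0 : ℂ) ?_ hc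
    rw [polarPoint_zero_left]
    exact hX.analyticAt.differentiableAt.hasFDerivAt
  have h2 := ((hasDerivAt_pi.1 h1.snd) l).sub ((hasDerivAt_XiZ_left z l).mul h1.fst)
  refine h2.congr_deriv ?_
  simp [polarPoint_zero_left]

/-- The part of the tangency equations that is linear in `ζ`. -/
theorem linear_relation (hX : IsAutNear X u) (l : Fin 8) : ∀ᶠ z in 𝓝 (0 : ℂ),
    ∑ j, linXi z j * (_root_.dW j X (0, realPoint u)).2 l =
      dlinXi z l * (X (z, realPoint u)).1 -
      2 * Complex.I * (if l = 0 then 1 else 0) * (X (0, realPoint u)).1 +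
      quadXi z l * conj (X (0, realPoint u)).1 +
      linXi z l * (conj (fderiv ℂ X (0, realPoint u) (1, 0)).1 -
        ∑ j, linXi z j * conj (_root_.dW j X (0, realPoint u)).1) := by
  have ht : Tendsto (fun z : ℂ => ((z, realPoint u) : C9)) (𝓝 0) (𝓝 (0, realPoint u)) :=
    Continuous.tendsto' (by fun_prop) _ _ rfl
  have hp := (hX.polarCoeff_eq_conj l)
  rw [← Prod.mk_zero_zero, nhds_prod_eq] at hp
  -- Since ∂_j X is itself an automorphism, its components at (z, u) are expressed by their values
  -- at (0, u).
  have hW : ∀ᶠ z in 𝓝 (0 : ℂ), ∀ j, (_root_.dW j X (z, realPoint u)).2 l =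
      (_root_.dW j X (0, realPoint u)).2 l +
        linXi z l * conj (_root_.dW j X (0, realPoint u)).1 :=
    eventually_all.2 fun j => (hX.dW j).snd_eq l
  filter_upwards [ht.eventually hX.analyticAt.eventually_analyticAt, hp.curry, hW] with z h1 h2 h3
  have d1 := hasDerivAt_polarCoeff_right (u := u) h1.differentiableAt l
  have d2 := (hX.hasDerivAt_polarCoeff_left z l)
  -- The base point 0 is written as conj 0 so that ζ ↦ conj g(ζ̄) can be differentiated at 0, with
  -- derivative conj g'(0).
  rw [← map_zero (starRingEnd ℂ)] at d2
  have d3 := d2.conj_conj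
  rw [map_zero, map_zero] at d3
  have e := d1.unique (d3.congr_of_eventuallyEq h2)
  have hs : ((1, (1 / 2 : ℂ) • XiZ 0 (conj z)) : C9) =
      (1, 0) + (0, (1 / 2 : ℂ) • XiZ 0 (conj z)) := by simp
  have hr : ∀ j, conj ((_root_.dW j X (0, realPoint u)).2 l) =
      (_root_.dW j X (0, realPoint u)).2 l := fun j =>
    Complex.conj_eq_iff_im.2 ((hX.dW j).snd_im_eq_zero l)
  have hd : conj (dlinXi 0 l) = -(2 * Complex.I * (if l = 0 then 1 else 0)) := by
    fin_cases l <;> simp [dlinXi, Complex.conj_ofNat]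
  rw [hs, map_add, fderiv_snd_eq_sum, fderiv_snd_eq_sum] at e
  simp only [Prod.snd_sum, Prod.fst_sum, Prod.fst_add, Prod.snd_add, Pi.add_apply, Finset.sum_apply,
    Prod.smul_fst, Prod.smul_snd, Pi.smul_apply, smul_eq_mul, hX.fderiv_fst_snd, h3, map_sub,
    map_add, map_mul, map_sum, map_neg, conj_XiZ_zero_conj, Complex.conj_conj, hr, hd, map_div₀,
    map_one, Complex.conj_ofNat] at e
  have c1 : ∀ f : Fin 8 → ℂ, ∑ j, 1 / 2 * linXi z j * f j = (1 / 2) * ∑ j, linXi z j * f j := by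
    intro f
    rw [Finset.mul_sum]
    exact Finset.sum_congr rfl fun j _ => by ring
  have c2 : ∀ f : Fin 8 → ℂ, ∑ j, 1 / 2 * -linXi z j * f j = -(1 / 2) * ∑ j, linXi z j * f j := by
    intro f
    rw [Finset.mul_sum]
    exact Finset.sum_congr rfl fun j _ => by ring
  have c3 : ∀ f g : Fin 8 → ℂ, ∑ j, linXi z j * (f j + linXi z l * g j) =
      ∑ j, linXi z j * f j + linXi z l * ∑ j, linXi z j * g j := by
    intro f g
    rw [Finset.mul_sum, ← Finset.sum_add_distrib]
    exact Finset.sum_congr rfl fun j _ => by ring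
  rw [c1, c2, c2, c3] at e
  linear_combination e

end IsAutNear

/-! ### Comparison of powers of z in the linear relations. -/

theorem coeff_eq_zero_of_eventually {n : ℕ} {a : Fin n → ℂ}
    (h : ∀ᶠ z in 𝓝 (0 : ℂ), ∑ i, a i * z ^ (i : ℕ) = 0) (i : Fin n) : a i = 0 := by
  set P : Polynomial ℂ := ∑ i : Fin n, Polynomial.monomial (i : ℕ) (a i) with hP
  have h0 : P = 0 := by
    refine Polynomial.eq_zero_of_infinite_isRoot P ?_
    refine (infinite_of_mem_nhds (0 : ℂ) h).mono fun z hz => ?_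
    simpa [hP, Polynomial.IsRoot, Polynomial.eval_finsetSum] using hz
  have hc : P.coeff i = a i := by
    rw [hP, Polynomial.finsetSum_coeff, Finset.sum_eq_single i]
    · simp
    · intro j _ hj
      rw [Polynomial.coeff_monomial, if_neg]
      exact fun h => hj (Fin.ext h)
    · simp
  rw [← hc, h0, Polynomial.coeff_zero]

/-- The numbers ∂_j W^l(0, u) are real, so the vanishing of one combination ∂_j − i∂_k kills both
derivatives. -/
theorem eq_zero_of_sub_I_mul {x y : ℂ} (hx : x.im = 0) (hy : y.im = 0)
    (h : x - Complex.I * y = 0) : x = 0 ∧ y = 0 := by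
  have h1 := congrArg Complex.re h
  have h2 := congrArg Complex.im h
  simp [hx, hy] at h1 h2
  exact ⟨Complex.ext h1 hx, Complex.ext h2 hy⟩

/-- The four complex directional derivatives occurring in the linear relations. -/
noncomputable def dirs (G : Fin 8 → ℂ) : Fin 4 → ℂ :=
  ![G 0, G 1 - Complex.I * G 2, G 3 - Complex.I * G 4, G 6 - Complex.I * G 7]

/-- Directions with the same power of z in `linXi` combine into one complex direction. Direction 5
drops out since `linXi z 5 = 0`. -/
theorem sum_linXi_mul (z : ℂ) (G : Fin 8 → ℂ) : ∑ j, linXi z j * G j =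
    2 * Complex.I * (z * dirs G 0 + z ^ 2 * dirs G 1 + z ^ 3 * dirs G 2 + z ^ 4 * dirs G 3) := by
  simp [Fin.sum_univ_eight, linXi, dirs]
  linear_combination (2 * (z ^ 2 * G 2 + z ^ 3 * G 4 + z ^ 4 * G 7)) * Complex.I_sq

namespace IsAutNear

variable {X : C9 → C9} {u : Fin 8 → ℝ}

/-- The expansion of the coefficient of `∂_z` in `z`. -/
theorem fst_eq (hX : IsAutNear X u) {F B : Fin 8 → ℂ} {A : ℂ}
    (hF : F = fun j => (_root_.dW j X (0, realPoint u)).2 0)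
    (hB : B = fun j => conj (_root_.dW j X (0, realPoint u)).1)
    (hA : A = conj (fderiv ℂ X (0, realPoint u) (1, 0)).1) :
    ∀ᶠ z in 𝓝 (0 : ℂ), (X (z, realPoint u)).1 = (X (0, realPoint u)).1 +
      (dirs F 0 - A) * z + (dirs F 1 + 2 * Complex.I * dirs B 0) * z ^ 2 +
      (dirs F 2 + 2 * Complex.I * dirs B 1) * z ^ 3 +
      (dirs F 3 + 2 * Complex.I * dirs B 2) * z ^ 4 + 2 * Complex.I * dirs B 3 * z ^ 5 := by
  -- For l = 0 the factor `dlinXi` is the nonzero constant 2i, so the relation can be solved for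
  -- Z(z, u).
  filter_upwards [hX.linear_relation 0] with z hz
  have e1 := sum_linXi_mul z F
  have e2 := sum_linXi_mul z B
  rw [hF] at e1
  rw [hB] at e2
  rw [e1, e2, ← hF, ← hB, ← hA] at hz
  simp only [dlinXi, linXi, quadXi, Matrix.cons_val_zero, if_true] at hz
  have hI : (2 * Complex.I) ≠ 0 := by simp
  refine mul_left_cancel₀ hI ?_
  linear_combination -hz

/-- The coefficients of the linear relation. -/
theorem coeffs (hX : IsAutNear X u) {F F3 F5 F6 B : Fin 8 → ℂ} {A c : ℂ}
    (hF : F = fun j => (_root_.dW j X (0, realPoint u)).2 0)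
    (hF3 : F3 = fun j => (_root_.dW j X (0, realPoint u)).2 3)
    (hF5 : F5 = fun j => (_root_.dW j X (0, realPoint u)).2 5)
    (hF6 : F6 = fun j => (_root_.dW j X (0, realPoint u)).2 6)
    (hB : B = fun j => conj (_root_.dW j X (0, realPoint u)).1)
    (hA : A = conj (fderiv ℂ X (0, realPoint u) (1, 0)).1)
    (hc : c = (X (0, realPoint u)).1) :
    (dirs F3 0 = 0 ∧ dirs F3 1 = 3 * c ∧ dirs F3 2 = 3 * (dirs F 0 - A) + A ∧
      dirs F3 3 = 3 * (dirs F 1 + 2 * Complex.I * dirs B 0) - 2 * Complex.I * dirs B 0) ∧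
    (dirs F5 0 = 0 ∧ dirs F5 1 = 2 * conj c ∧ dirs F5 2 = 0 ∧ dirs F5 3 = 0) ∧
    (dirs F6 0 = 0 ∧ dirs F6 1 = 0 ∧ dirs F6 2 = 4 * c ∧ dirs F6 3 = 4 * (dirs F 0 - A) + A) ∧
    (4 * (dirs F 1 + 2 * Complex.I * dirs B 0) = 2 * Complex.I * dirs B 0 ∧
      4 * (dirs F 2 + 2 * Complex.I * dirs B 1) = 2 * Complex.I * dirs B 1 ∧
      4 * (dirs F 3 + 2 * Complex.I * dirs B 2) = 2 * Complex.I * dirs B 2 ∧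
      4 * (2 * Complex.I * dirs B 3) = 2 * Complex.I * dirs B 3) := by
  have hZ := hX.fst_eq hF hB hA
  have e2 := fun z => sum_linXi_mul z B
  have e3 := fun z => sum_linXi_mul z F3
  have e5 := fun z => sum_linXi_mul z F5
  have e6 := fun z => sum_linXi_mul z F6
  simp only [hB] at e2
  simp only [hF3] at e3
  simp only [hF5] at e5
  simp only [hF6] at e6
  have hI : (2 * Complex.I) ≠ 0 := by simp
  refine ⟨?_, ?_, ?_⟩
  · have h := coeff_eq_zero_of_eventually (a := ![0, dirs F3 0, dirs F3 1 - 3 * c,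
      dirs F3 2 - (3 * (dirs F 0 - A) + A), dirs F3 3 -
      (3 * (dirs F 1 + 2 * Complex.I * dirs B 0) - 2 * Complex.I * dirs B 0),
      -(3 * (dirs F 2 + 2 * Complex.I * dirs B 1) - 2 * Complex.I * dirs B 1),
      -(3 * (dirs F 3 + 2 * Complex.I * dirs B 2) - 2 * Complex.I * dirs B 2),
      -(3 * (2 * Complex.I * dirs B 3) - 2 * Complex.I * dirs B 3)]) (by
        filter_upwards [hX.linear_relation 3, hZ] with z hz hz'
        rw [e2, e3, ← hA, hz'] at hz
        rw [← hB, ← hF3, ← hc] at hz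
        simp [dlinXi, linXi, quadXi] at hz
        simp [Fin.sum_univ_succ]
        refine mul_left_cancel₀ hI ?_
        linear_combination hz)
    exact ⟨h 1, sub_eq_zero.1 (h 2), sub_eq_zero.1 (h 3), sub_eq_zero.1 (h 4)⟩
  · have h := coeff_eq_zero_of_eventually (a := ![0, dirs F5 0, dirs F5 1 - 2 * conj c,
      dirs F5 2, dirs F5 3]) (by
        filter_upwards [hX.linear_relation 5, hZ] with z hz hz'
        rw [e2, e5, ← hA, hz'] at hz
        rw [← hB, ← hF5, ← hc] at hz
        simp [dlinXi, linXi, quadXi] at hz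
        simp [Fin.sum_univ_succ]
        refine mul_left_cancel₀ hI ?_
        linear_combination hz)
    exact ⟨h 1, sub_eq_zero.1 (h 2), h 3, h 4⟩
  -- For l = 6 the factors are 8i z³ in front of Z and 2i z⁴ in the last term, while the derivatives
  -- of W^6 reach only degree 4. Degrees 5 to 8 therefore constrain the coefficients of Z and B
  -- alone.
  · have h := coeff_eq_zero_of_eventually (a := ![0, dirs F6 0, dirs F6 1, dirs F6 2 - 4 * c,
      dirs F6 3 - (4 * (dirs F 0 - A) + A),
      -(4 * (dirs F 1 + 2 * Complex.I * dirs B 0) - 2 * Complex.I * dirs B 0),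
      -(4 * (dirs F 2 + 2 * Complex.I * dirs B 1) - 2 * Complex.I * dirs B 1),
      -(4 * (dirs F 3 + 2 * Complex.I * dirs B 2) - 2 * Complex.I * dirs B 2),
      -(4 * (2 * Complex.I * dirs B 3) - 2 * Complex.I * dirs B 3)]) (by
        filter_upwards [hX.linear_relation 6, hZ] with z hz hz'
        rw [e2, e6, ← hA, hz'] at hz
        rw [← hB, ← hF6, ← hc] at hz
        simp [dlinXi, linXi, quadXi] at hz
        simp [Fin.sum_univ_succ]
        refine mul_left_cancel₀ hI ?_
        linear_combination hz)
    exact ⟨⟨h 1, h 2, sub_eq_zero.1 (h 3), sub_eq_zero.1 (h 4)⟩,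
      sub_eq_zero.1 (neg_eq_zero.1 (h 5)), sub_eq_zero.1 (neg_eq_zero.1 (h 6)),
      sub_eq_zero.1 (neg_eq_zero.1 (h 7)), sub_eq_zero.1 (neg_eq_zero.1 (h 8))⟩

/-- The coefficient of `z` in the expansion of the coefficient of `∂_z`. -/
theorem conj_linear_coeff (hX : IsAutNear X u) :
    (fderiv ℂ X (0, realPoint u) (1, 0)).1 + conj (fderiv ℂ X (0, realPoint u) (1, 0)).1 =
      (_root_.dW 0 X (0, realPoint u)).2 0 := by
  have h1 : HasDerivAt (fun z : ℂ => (X (z, realPoint u)).1)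
      (fderiv ℂ X (0, realPoint u) (1, 0)).1 0 :=
    (HasFDerivAt.comp_hasDerivAt (f := fun z : ℂ => ((z, realPoint u) : C9)) (0 : ℂ)
      hX.analyticAt.differentiableAt.hasFDerivAt
      ((hasDerivAt_id (0 : ℂ)).prodMk (hasDerivAt_const _ _))).fst
  have hm : ∀ (c : ℂ) (m : ℕ), HasDerivAt (fun z : ℂ => c * z ^ m) (c * (m * 0 ^ (m - 1))) 0 :=
    fun c m => (hasDerivAt_pow m (0 : ℂ)).const_mul c
  have h2 := ((((((hasDerivAt_const (0 : ℂ) (X (0, realPoint u)).1).add (hm _ 1)).add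
    (hm _ 2)).add (hm _ 3)).add (hm _ 4)).add (hm _ 5)).congr_of_eventuallyEq
      (hX.fst_eq rfl rfl rfl |>.mono fun z hz => by
        simp only [Pi.add_apply, pow_one]
        exact hz)
  have h3 := h1.unique h2
  simp [dirs] at h3
  linear_combination h3

end IsAutNear

/-! ### Expansion along the curve `z = ζ = ε` -/

/-- `XiC ε ε / (2 ε²)`. -/
noncomputable def diagDir (ε : ℝ) : Fin 8 → ℝ := ![1, 2 * ε, 0, 2 * ε ^ 2, 0, ε ^ 2, 2 * ε ^ 3, 0]

theorem continuous_diagDir : Continuous diagDir := by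
  refine continuous_pi fun j => ?_
  fin_cases j <;> simp [diagDir] <;> fun_prop

theorem polarPoint_diag (u : Fin 8 → ℝ) (ε : ℝ) : polarPoint u ((ε : ℂ), (ε : ℂ)) =
    ((ε : ℂ), realPoint u + Complex.I • realPoint (ε ^ 2 • diagDir ε)) := by
  refine Prod.ext rfl ?_
  funext j
  simp only [polarPoint, Pi.add_apply, Pi.smul_apply, smul_eq_mul]
  congr 1
  fin_cases j <;> simp [realPoint, diagDir, XiC] <;> ring

/-- Even Taylor terms cancel in the odd part, and the remainder is cubic in a displacement of size
ε², hence O(ε⁶). In the linear term the orders ε² and ε³ belong to directions 0 and 1, killed by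
`h0` and `h1`; at ε⁴ directions 3 and 5 remain with weights 2 and 1. -/
theorem tendsto_odd_part_div {f : (Fin 8 → ℂ) → ℂ} {x : Fin 8 → ℂ} (hf : AnalyticAt ℂ f x)
    (h0 : fderiv ℂ f x (Pi.single 0 1) = 0) (h1 : fderiv ℂ f x (Pi.single 1 1) = 0) :
    Tendsto (fun ε : ℝ => (f (x + Complex.I • realPoint (ε ^ 2 • diagDir ε)) -
      f (x - Complex.I • realPoint (ε ^ 2 • diagDir ε))) / (ε : ℂ) ^ 4) (𝓝[≠] 0)
      (𝓝 (2 * Complex.I * (2 * fderiv ℂ f x (Pi.single 3 1) +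
        fderiv ℂ f x (Pi.single 5 1)))) := by
  obtain ⟨p, hp⟩ := hf
  set y : ℝ → Fin 8 → ℂ := fun ε => Complex.I • realPoint (ε ^ 2 • diagDir ε) with hy
  set R : (Fin 8 → ℂ) → ℂ := fun v => f (x + v) - p.partialSum 3 v with hR
  have hRO : R =O[𝓝 0] fun v => ‖v‖ ^ 3 := hp.isBigO_sub_partialSum_pow 3
  have hyn : ∀ ε, ‖y ε‖ = ε ^ 2 * ‖diagDir ε‖ := by
    intro ε
    rw [hy]
    simp only [norm_smul, Complex.norm_I, one_mul, norm_realPoint, norm_pow, Real.norm_eq_abs,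
      sq_abs]
  have hyc : Continuous y := by
    have h1 := continuous_diagDir
    have h2 := continuous_realPoint
    fun_prop
  have hrem : ∀ g : ℝ → Fin 8 → ℂ, Continuous g → (∀ ε, ‖g ε‖ = ε ^ 2 * ‖diagDir ε‖) →
      Tendsto (fun ε : ℝ => R (g ε) / (ε : ℂ) ^ 4) (𝓝[≠] 0) (𝓝 0) := by
    intro g hg hgn
    have hg0 : Tendsto g (𝓝 0) (𝓝 0) := by
      refine hg.tendsto' _ _ ?_
      rw [← norm_eq_zero, hgn]
      simp
    have hO := (hRO.comp_tendsto hg0).mono (nhdsWithin_le_nhds (s := {(0 : ℝ)}ᶜ))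
    obtain ⟨C, hC⟩ := hO.bound
    have hlim : Tendsto (fun ε : ℝ => C * (ε ^ 2 * ‖diagDir ε‖ ^ 3)) (𝓝[≠] 0) (𝓝 0) := by
      refine tendsto_nhdsWithin_of_tendsto_nhds (Continuous.tendsto' ?_ _ _ (by simp))
      exact continuous_const.mul ((continuous_id.pow 2).mul (continuous_diagDir.norm.pow 3))
    refine squeeze_zero_norm' ?_ hlim
    filter_upwards [hC, self_mem_nhdsWithin] with ε h hε
    have hε' : 0 < |ε| ^ 4 := pow_pos (abs_pos.2 hε) 4
    rw [norm_div, norm_pow, Complex.norm_real, Real.norm_eq_abs, div_le_iff₀ hε']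
    refine h.trans (le_of_eq ?_)
    simp only [Function.comp_apply, hgn, norm_pow, norm_mul, abs_norm, Real.norm_eq_abs, sq_abs]
    rw [show |ε| ^ 4 = (|ε| ^ 2) ^ 2 by ring, sq_abs]
    ring
  have hr1 := hrem y hyc hyn
  have hr2 := hrem (fun ε => -y ε) hyc.neg fun ε => by rw [norm_neg, hyn]
  have hmain : Tendsto (fun ε : ℝ => 2 * Complex.I * (2 * fderiv ℂ f x (Pi.single 3 1) +
      fderiv ℂ f x (Pi.single 5 1) + 2 * (ε : ℂ) * fderiv ℂ f x (Pi.single 6 1))) (𝓝[≠] 0)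
      (𝓝 (2 * Complex.I * (2 * fderiv ℂ f x (Pi.single 3 1) +
        fderiv ℂ f x (Pi.single 5 1)))) := by
    refine tendsto_nhdsWithin_of_tendsto_nhds (Continuous.tendsto' (by fun_prop) _ _ (by simp))
  have hsum := hmain.add (hr1.sub hr2)
  rw [sub_zero, add_zero] at hsum
  refine hsum.congr' ?_
  filter_upwards [self_mem_nhdsWithin] with ε hε
  have hε' : (ε : ℂ) ≠ 0 := by simpa using hε
  have hodd : p.partialSum 3 (y ε) - p.partialSum 3 (-y ε) = 2 * fderiv ℂ f x (y ε) := by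
    have e2 : (p 2 fun _ => -y ε) = p 2 fun _ => y ε := by
      have h := (p 2).map_smul_univ (fun _ => (-1 : ℂ)) (fun _ => y ε)
      simpa using h
    have e1 : (p 1 fun _ => -y ε) = -p 1 fun _ => y ε := by
      have h := (p 1).map_smul_univ (fun _ => (-1 : ℂ)) (fun _ => y ε)
      simpa using h
    have e0 : (p 0 fun _ => -y ε) = p 0 fun _ => y ε := congrArg _ (funext fun i => i.elim0)
    have ef : fderiv ℂ f x (y ε) = p 1 fun _ => y ε := by
      rw [hp.fderiv_eq]
      rfl
    simp only [FormalMultilinearSeries.partialSum, Finset.sum_range_succ, Finset.sum_range_zero,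
      e0, e1, e2, ef]
    ring
  have hfd : fderiv ℂ f x (y ε) = Complex.I * (ε : ℂ) ^ 4 * (2 * fderiv ℂ f x (Pi.single 3 1) +
      fderiv ℂ f x (Pi.single 5 1) + 2 * (ε : ℂ) * fderiv ℂ f x (Pi.single 6 1)) := by
    have hs : y ε = ∑ j, y ε j • (Pi.single j (1 : ℂ) : Fin 8 → ℂ) := pi_eq_sum_univ' _
    rw [hs, map_sum]
    simp only [map_smul, Fin.sum_univ_eight, h0, h1, smul_eq_mul]
    simp [hy, realPoint, diagDir]
    ring
  simp only [hR]
  rw [← sub_div, ← sub_eq_add_neg]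
  field_simp
  linear_combination -hodd - 2 * hfd

/-! ### Recovering the derivative in direction 5 from the diagonal curve. -/

namespace IsAutNear

variable {X : C9 → C9} {u : Fin 8 → ℝ}

theorem analyticAt_restrict (hX : IsAutNear X u) (l : Fin 8) :
    AnalyticAt ℂ (fun w => (X (0, w)).2 l) (realPoint u) := by
  have h1 : AnalyticAt ℂ (fun w : Fin 8 → ℂ => X (0, w)) (realPoint u) :=
    AnalyticAt.fun_comp (g := X) (f := fun w : Fin 8 → ℂ => ((0, w) : C9)) hX.analyticAt
      (analyticAt_const.prod analyticAt_id)
  exact ((ContinuousLinearMap.proj (R := ℂ) (φ := fun _ : Fin 8 => ℂ) l).comp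
    (ContinuousLinearMap.snd ℂ ℂ (Fin 8 → ℂ))).analyticAt _ |>.fun_comp h1

theorem fderiv_restrict (hX : IsAutNear X u) (l j : Fin 8) :
    fderiv ℂ (fun w => (X (0, w)).2 l) (realPoint u) (Pi.single j 1) =
      (_root_.dW j X (0, realPoint u)).2 l := by
  have h1 : HasFDerivAt (fun w : Fin 8 → ℂ => X (0, w))
      ((fderiv ℂ X (0, realPoint u)).comp (ContinuousLinearMap.inr ℂ ℂ (Fin 8 → ℂ)))
      (realPoint u) :=
    HasFDerivAt.comp (f := fun w : Fin 8 → ℂ => ((0, w) : C9)) (realPoint u)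
      hX.analyticAt.differentiableAt.hasFDerivAt (hasFDerivAt_prodMk_right _ _)
  have h2 := ((ContinuousLinearMap.proj (R := ℂ) (φ := fun _ : Fin 8 => ℂ) l).comp
    (ContinuousLinearMap.snd ℂ ℂ (Fin 8 → ℂ))).hasFDerivAt.comp (realPoint u) h1
  have h3 := h2.fderiv
  change fderiv ℂ (fun w => (X (0, w)).2 l) (realPoint u) = _ at h3
  rw [h3]
  rfl

/-- The odd part of `W^l(0, ·)` along the diagonal curve is twice its imaginary part. -/
theorem eventually_restrict_conj (hX : IsAutNear X u) (l : Fin 8) : ∀ᶠ ε : ℝ in 𝓝 0,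
    (X (0, realPoint u + Complex.I • realPoint (ε ^ 2 • diagDir ε))).2 l =
      conj ((X (0, realPoint u - Complex.I • realPoint (ε ^ 2 • diagDir ε))).2 l) := by
  have h := eventually_eq_conj_of_real_on_real (u := u) (f := fun w => (X (0, w)).2 l)
    ((hX.analyticAt_restrict l).eventually_analyticAt.mono fun w hw => hw.differentiableAt)
    (hX.eventually.mono fun v hv => hv.snd_im_eq_zero l)
  have ht : Tendsto (fun ε : ℝ => (u, ε ^ 2 • diagDir ε)) (𝓝 0) (𝓝 (u, 0)) := by
    refine Continuous.tendsto' ?_ _ _ (by simp)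
    exact continuous_const.prodMk ((continuous_id.pow 2).smul continuous_diagDir)
  exact ht.eventually h

/-- W^l(0, ·) is real at real points, so its odd part on the curve is 2i times its imaginary part.
This makes ∂_5 W^l accessible through the tangency condition. -/
theorem tendsto_im_diag (hX : IsAutNear X u) (l : Fin 8)
    (h0 : (_root_.dW 0 X (0, realPoint u)).2 l = 0)
    (h1 : (_root_.dW 1 X (0, realPoint u)).2 l = 0) :
    Tendsto (fun ε : ℝ =>
      ((X (0, realPoint u + Complex.I • realPoint (ε ^ 2 • diagDir ε))).2 l).im / ε ^ 4)
      (𝓝[≠] 0) (𝓝 (2 * (_root_.dW 3 X (0, realPoint u)).2 l +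
        (_root_.dW 5 X (0, realPoint u)).2 l).re) := by
  have h := tendsto_odd_part_div (hX.analyticAt_restrict l)
    ((hX.fderiv_restrict l 0).trans h0) ((hX.fderiv_restrict l 1).trans h1)
  rw [hX.fderiv_restrict, hX.fderiv_restrict] at h
  have h' := (Complex.continuous_im.tendsto _).comp (h.div_const 2)
  refine (h'.congr' ?_).trans (le_of_eq ?_)
  · filter_upwards [nhdsWithin_le_nhds (hX.eventually_restrict_conj l)] with ε hε
    have hc := congrArg conj hε
    rw [Complex.conj_conj] at hc
    simp only [Function.comp_apply]
    rw [← hc, Complex.sub_conj]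
    have : ((2 * ((X (0, realPoint u + Complex.I • realPoint (ε ^ 2 • diagDir ε))).2 l).im : ℝ) *
        Complex.I / (ε : ℂ) ^ 4 / 2 : ℂ) =
        (((X (0, realPoint u + Complex.I • realPoint (ε ^ 2 • diagDir ε))).2 l).im / ε ^ 4 : ℝ) *
        Complex.I := by
      push_cast
      ring
    rw [this, Complex.mul_I_im, Complex.ofReal_re]
  · congr 1
    rw [mul_assoc, mul_div_cancel_left₀ _ (two_ne_zero)]
    simp

theorem tendsto_diag_point (u : Fin 8 → ℝ) :
    Tendsto (fun ε : ℝ => polarPoint u ((ε : ℂ), (ε : ℂ))) (𝓝 0) (𝓝 (0, realPoint u)) := by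
  refine (tendsto_polarPoint u).comp (Continuous.tendsto' ?_ _ _ (by simp))
  exact Complex.continuous_ofReal.prodMk Complex.continuous_ofReal

theorem polarCoeff_diag_im (hX : IsAutNear X u) (l : Fin 8) : ∀ᶠ ε : ℝ in 𝓝 0,
    (polarCoeff X u l ((ε : ℂ), (ε : ℂ))).im = 0 := by
  filter_upwards [(tendsto_diag_point u).eventually hX.tangent] with ε hε
  have hm : polarPoint u ((ε : ℂ), (ε : ℂ)) ∈ M1 := by
    have := polarPoint_conj_mem u (ε : ℂ)
    rwa [Complex.conj_ofReal] at this
  have := (isTangentAt_iff _ _).1 (hε hm) l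
  rwa [show conj (polarPoint u ((ε : ℂ), (ε : ℂ))).1 = (ε : ℂ) from Complex.conj_ofReal ε] at this

/-- `snd_eq` holds only over real w, and conj Z(0, w) is not holomorphic. Since 2i conj Z(0, u) =
∂_z W^0(0, u), substituting the latter gives an identity of holomorphic functions, which extends
from real slices to a full neighbourhood. -/
theorem snd_six_near (hX : IsAutNear X u) : ∀ᶠ q in 𝓝 ((0, realPoint u) : C9),
    (X q).2 6 = (X (0, q.2)).2 6 + q.1 ^ 4 * (fderiv ℂ X (0, q.2) (1, 0)).2 0 := by
  have hs : AnalyticAt ℂ (fun q : C9 => ((0, q.2) : C9)) (0, realPoint u) :=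
    analyticAt_const.prod analyticAt_snd
  have hc : ∀ l : Fin 8, ∀ Y : C9 → C9, AnalyticAt ℂ Y (0, realPoint u) →
      AnalyticAt ℂ (fun q => (Y q).2 l) (0, realPoint u) := fun l Y hY =>
    ((ContinuousLinearMap.proj (R := ℂ) (φ := fun _ : Fin 8 => ℂ) l).comp
      (ContinuousLinearMap.snd ℂ ℂ (Fin 8 → ℂ))).analyticAt _ |>.fun_comp hY
  have hd : AnalyticAt ℂ (fun q : C9 => fderiv ℂ X (0, q.2) (1, 0)) (0, realPoint u) :=
    (ContinuousLinearMap.apply ℂ C9 ((1, 0) : C9)).analyticAt _ |>.fun_comp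
      (AnalyticAt.fun_comp (g := fderiv ℂ X) (f := fun q : C9 => ((0, q.2) : C9))
        hX.analyticAt.fderiv hs)
  have h := eventually_eq_zero_of_real_slices
    (h := fun q => (X q).2 6 - ((X (0, q.2)).2 6 + q.1 ^ 4 * (fderiv ℂ X (0, q.2) (1, 0)).2 0))
    (u := u) ?_ ?_
  · exact h.mono fun q hq => sub_eq_zero.1 hq
  · exact (hc 6 _ hX.analyticAt).fun_sub ((hc 6 _ (AnalyticAt.fun_comp (g := X)
      (f := fun q : C9 => ((0, q.2) : C9)) hX.analyticAt hs)).fun_add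
        ((analyticAt_fst.fun_pow 4).fun_mul (hc 0 _ hd)))
  · filter_upwards [hX.eventually] with v hv
    filter_upwards [hv.snd_eq 6] with z hz
    rw [hz, hv.fderiv_fst_snd]
    simp [linXi, dlinXi]
    ring

/-- Dividing the tangency equation for l = 6 along the curve by ε⁴ and letting ε → 0 gives 2∂_3W^6 +
∂_5W^6 + 2 Re Z − 10 Re Z = 0 at (0, u). The linear relations give ∂_3W^6 = 4 Re Z, and the Z terms
cancel. -/
theorem dW_five_six_eq_zero (hX : IsAutNear X u) : (_root_.dW 5 X (0, realPoint u)).2 6 = 0 := by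
  obtain ⟨-, -, ⟨k0, k1, k2, -⟩, -⟩ := hX.coeffs rfl rfl rfl rfl rfl rfl rfl
  have him : ∀ j, ((_root_.dW j X (0, realPoint u)).2 6).im = 0 := fun j =>
    (hX.dW j).snd_im_eq_zero 6
  have k1' := eq_zero_of_sub_I_mul (him 1) (him 2) k1
  have hT := hX.tendsto_im_diag 6 k0 k1'.1
  have hpt : Tendsto (fun ε : ℝ => polarPoint u ((ε : ℂ), (ε : ℂ))) (𝓝[≠] 0)
      (𝓝 (0, realPoint u)) := (tendsto_diag_point u).mono_left nhdsWithin_le_nhds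
  have hZ : Tendsto (fun ε : ℝ => (X (polarPoint u ((ε : ℂ), (ε : ℂ)))).1) (𝓝[≠] 0)
      (𝓝 (X (0, realPoint u)).1) :=
    ((continuous_fst.tendsto _).comp hX.analyticAt.continuousAt.tendsto).comp hpt
  have hB : Tendsto (fun ε : ℝ =>
      (fderiv ℂ X (0, (polarPoint u ((ε : ℂ), (ε : ℂ))).2) (1, 0)).2 0) (𝓝[≠] 0)
      (𝓝 ((fderiv ℂ X (0, realPoint u) (1, 0)).2 0)) := by
    have h1 : ContinuousAt (fun q : C9 => (fderiv ℂ X q (1, 0)).2 0) (0, realPoint u) :=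
      (((continuous_apply (0 : Fin 8)).comp continuous_snd).continuousAt).comp
        (hX.analyticAt.fderiv.continuousAt.clm_apply continuousAt_const)
    refine h1.tendsto.comp (Tendsto.prodMk_nhds tendsto_const_nhds ?_)
    exact (continuous_snd.tendsto _).comp hpt
  -- The factor 10i comes from Ξ^6_z = 2i(4z³ζ + ζ⁴) at z = ζ = ε, divided by ε⁴.
  have hlim := (hT.add ((Complex.continuous_im.tendsto _).comp hB)).sub
    ((Complex.continuous_im.tendsto _).comp (hZ.const_mul (10 * Complex.I)))
  have hz : Tendsto (fun _ : ℝ => (0 : ℝ)) (𝓝[≠] 0) (𝓝 0) := tendsto_const_nhds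
  have he := tendsto_nhds_unique (hlim.congr' ?_) hz
  · rw [hX.fderiv_fst_snd] at he
    have k2r := congrArg Complex.re k2
    simp [dirs, dlinXi, him] at he k2r
    refine Complex.ext ?_ (him 5)
    rw [Complex.zero_re]
    linarith
  · filter_upwards [nhdsWithin_le_nhds (hX.polarCoeff_diag_im 6), hpt.eventually hX.snd_six_near,
      self_mem_nhdsWithin] with ε h1 h2 hε
    have hε' : ε ≠ 0 := hε
    rw [polarCoeff, h2] at h1
    simp only [Function.comp_apply]
    rw [polarPoint_diag] at h1 ⊢
    have hp : (ε : ℂ) ^ 4 = ((ε ^ 4 : ℝ) : ℂ) := by push_cast; rfl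
    have hx : XiZ (ε : ℂ) (ε : ℂ) 6 = ((ε ^ 4 : ℝ) : ℂ) * (10 * Complex.I) := by
      simp [XiZ]
      ring
    rw [hx, mul_assoc ((ε ^ 4 : ℝ) : ℂ)] at h1
    simp only [hp, Complex.add_im, Complex.sub_im, Complex.im_ofReal_mul] at h1
    field_simp
    linarith

end IsAutNear

/-! ### Second derivatives and determination by the data at one point. -/

theorem fderiv_fderiv_apply_comm {X : C9 → C9} {q : C9} (hX : AnalyticAt ℂ X q) (v w : C9) :
    fderiv ℂ (fun p => fderiv ℂ X p v) q w = fderiv ℂ (fun p => fderiv ℂ X p w) q v := by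
  have hd : DifferentiableAt ℂ (fderiv ℂ X) q := hX.fderiv.differentiableAt
  have hs : IsSymmSndFDerivAt ℂ X q := hX.contDiffAt.isSymmSndFDerivAt_of_omega
  have h : ∀ v w, fderiv ℂ (fun p => fderiv ℂ X p v) q w = fderiv ℂ (fderiv ℂ X) q w v := by
    intro v w
    rw [fderiv_clm_apply hd (differentiableAt_const v)]
    simp
  rw [h, h, hs]

theorem dW_comm {X : C9 → C9} {q : C9} (hX : AnalyticAt ℂ X q) (j k : Fin 8) :
    dW j (dW k X) q = dW k (dW j X) q :=
  fderiv_fderiv_apply_comm hX _ _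

/-- A holomorphic function is constant along the real directions in which its derivatives vanish. -/
theorem eventually_eq_zero_of_fderiv_eq_zero {h : C9 → ℂ} {u : Fin 8 → ℝ}
    (hh : AnalyticAt ℂ h (0, realPoint u)) (h0 : h (0, realPoint u) = 0)
    (hd : ∀ᶠ v in 𝓝 u, ∀ k, fderiv ℂ h (0, realPoint v) (0, Pi.single k 1) = 0) :
    ∀ᶠ v in 𝓝 u, h (0, realPoint v) = 0 := by
  have ht : Tendsto (fun v : Fin 8 → ℝ => ((0, realPoint v) : C9)) (𝓝 u) (𝓝 (0, realPoint u)) :=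
    (continuous_const.prodMk continuous_realPoint).tendsto u
  obtain ⟨ε, hε, he⟩ := Metric.eventually_nhds_iff_ball.1
    ((ht.eventually hh.eventually_analyticAt).and hd)
  filter_upwards [Metric.ball_mem_nhds u hε] with v hv
  have hmem : ∀ t ∈ Set.Icc (0 : ℝ) 1, u + t • (v - u) ∈ Metric.ball u ε := by
    intro t ht
    rw [mem_ball_iff_norm] at hv ⊢
    rw [add_sub_cancel_left, norm_smul, Real.norm_eq_abs, abs_of_nonneg ht.1]
    exact (mul_le_of_le_one_left (norm_nonneg _) ht.2).trans_lt hv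
  have hder : ∀ t ∈ Set.Icc (0 : ℝ) 1, HasDerivWithinAt
      (fun t : ℝ => h (0, realPoint (u + t • (v - u)))) 0 (Set.Icc 0 1) t := by
    intro t ht
    obtain ⟨ha, hz⟩ := he _ (hmem t ht)
    have hc : HasDerivAt (fun t : ℝ => ((0, realPoint (u + t • (v - u))) : C9))
        (0, realPoint (v - u)) t := by
      refine (hasDerivAt_const _ _).prodMk (hasDerivAt_pi.2 fun j => ?_)
      have h1 : HasDerivAt (fun t : ℝ => u j + t * (v - u) j) ((v - u) j) t := by
        simpa using ((hasDerivAt_id t).mul_const ((v - u) j)).const_add (u j)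
      exact h1.ofReal_comp
    have h2 : HasDerivAt (fun t : ℝ => h (0, realPoint (u + t • (v - u))))
        (fderiv ℂ h (0, realPoint (u + t • (v - u))) (0, realPoint (v - u))) t :=
      HasFDerivAt.comp_hasDerivAt (l := h) (f := fun t : ℝ => ((0, realPoint (u + t • (v - u))) : C9))
        t (ha.differentiableAt.hasFDerivAt.restrictScalars ℝ) hc
    have h3 : fderiv ℂ h (0, realPoint (u + t • (v - u))) (0, realPoint (v - u)) = 0 := by
      have hs : ((0, realPoint (v - u)) : C9) =
          ∑ j, realPoint (v - u) j • ((0, Pi.single j 1) : C9) := by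
        refine Prod.ext ?_ ?_
        · simp [Prod.fst_sum]
        · simp only [Prod.snd_sum, Prod.smul_snd]
          rw [← pi_eq_sum_univ' (realPoint (v - u))]
      rw [hs, map_sum]
      exact Finset.sum_eq_zero fun j _ => by rw [map_smul, hz j, smul_zero]
    rw [h3] at h2
    exact h2.hasDerivWithinAt
  have hle := Convex.norm_image_sub_le_of_norm_hasDerivWithin_le (C := 0) hder
    (fun _ _ => by simp) (convex_Icc 0 1) (Set.left_mem_Icc.2 zero_le_one)
    (Set.right_mem_Icc.2 zero_le_one)
  rw [zero_mul, norm_le_zero_iff, zero_smul, add_zero, one_smul, add_sub_cancel, h0, sub_zero] at hle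
  exact hle

theorem analyticAt_snd_apply {X : C9 → C9} {q : C9} (hX : AnalyticAt ℂ X q) (l : Fin 8) :
    AnalyticAt ℂ (fun q => (X q).2 l) q :=
  ((ContinuousLinearMap.proj (R := ℂ) (φ := fun _ : Fin 8 => ℂ) l).comp
    (ContinuousLinearMap.snd ℂ ℂ (Fin 8 → ℂ))).analyticAt _ |>.fun_comp hX

theorem analyticAt_fst_apply {X : C9 → C9} {q : C9} (hX : AnalyticAt ℂ X q) :
    AnalyticAt ℂ (fun q => (X q).1) q :=
  (ContinuousLinearMap.fst ℂ ℂ (Fin 8 → ℂ)).analyticAt _ |>.fun_comp hX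

theorem fderiv_fst_apply {X : C9 → C9} {q : C9} (hX : AnalyticAt ℂ X q) (v : C9) :
    fderiv ℂ (fun q => (X q).1) q v = (fderiv ℂ X q v).1 := by
  rw [hX.differentiableAt.hasFDerivAt.fst.fderiv]
  rfl

theorem fderiv_snd_apply {X : C9 → C9} {q : C9} (hX : AnalyticAt ℂ X q) (l : Fin 8) (v : C9) :
    fderiv ℂ (fun q => (X q).2 l) q v = (fderiv ℂ X q v).2 l := by
  have h := (hasFDerivAt_pi'.1 hX.differentiableAt.hasFDerivAt.snd) l
  rw [h.fderiv]
  rfl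

theorem analyticAt_fderiv_apply {X : C9 → C9} {q : C9} (hX : AnalyticAt ℂ X q) (v : C9) :
    AnalyticAt ℂ (fun q => fderiv ℂ X q v) q :=
  (ContinuousLinearMap.apply ℂ C9 v).analyticAt _ |>.fun_comp hX.fderiv

/-- The equation multiplies the real part by r + 1 and the imaginary part by r − 1, both nonzero. -/
theorem eq_zero_of_smul_add_conj {a : ℂ} {r : ℝ} (hr : 1 < r) (h : (r : ℂ) * a + conj a = 0) :
    a = 0 := by
  have h1 := congrArg Complex.re h
  have h2 := congrArg Complex.im h
  simp at h1 h2
  refine Complex.ext ?_ ?_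
  · have : (r + 1) * a.re = 0 := by linarith
    rcases mul_eq_zero.1 this with h | h
    · linarith
    · simpa using h
  · have : (r - 1) * a.im = 0 := by linarith
    rcases mul_eq_zero.1 this with h | h
    · linarith
    · simpa using h

namespace IsAutNear

variable {X : C9 → C9} {u : Fin 8 → ℝ}

theorem dW_im (hX : IsAutNear X u) (j l : Fin 8) :
    ((_root_.dW j X (0, realPoint u)).2 l).im = 0 :=
  (hX.dW j).snd_im_eq_zero l

theorem dW_five (hX : IsAutNear X u) {k : Fin 8} (hk : k ∈ ({0, 3, 4, 6, 7} : Finset (Fin 8))) :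
    (_root_.dW k X (0, realPoint u)).2 5 = 0 := by
  obtain ⟨-, ⟨h0, -, h2, h3⟩, -⟩ := hX.coeffs rfl rfl rfl rfl rfl rfl rfl
  have h2' := eq_zero_of_sub_I_mul (hX.dW_im 3 5) (hX.dW_im 4 5) h2
  have h3' := eq_zero_of_sub_I_mul (hX.dW_im 6 5) (hX.dW_im 7 5) h3
  fin_cases hk
  exacts [h0, h2'.1, h2'.2, h3'.1, h3'.2]

theorem dW_six (hX : IsAutNear X u) {k : Fin 8} (hk : k ∈ ({0, 1, 2, 5} : Finset (Fin 8))) :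
    (_root_.dW k X (0, realPoint u)).2 6 = 0 := by
  obtain ⟨-, -, ⟨h0, h1, -⟩, -⟩ := hX.coeffs rfl rfl rfl rfl rfl rfl rfl
  have h1' := eq_zero_of_sub_I_mul (hX.dW_im 1 6) (hX.dW_im 2 6) h1
  fin_cases hk
  exacts [h0, h1'.1, h1'.2, hX.dW_five_six_eq_zero]

/-- Two relations are applied to ∂_k X: (∂_1 − i∂_2)W^5 = 2 conj Z and (∂_3 − i∂_4)W^6 = 4Z. After
exchanging derivatives, the first has zero left side when ∂_k W^5 = 0, the second when ∂_k W^6 = 0,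
and every k falls under one of them. -/
theorem dW_fst (hX : IsAutNear X u) (k : Fin 8) : (_root_.dW k X (0, realPoint u)).1 = 0 := by
  have hs := fun j => dW_comm hX.analyticAt j k
  obtain ⟨-, ⟨-, h5, -⟩, ⟨-, -, h6, -⟩, -⟩ := (hX.dW k).coeffs rfl rfl rfl rfl rfl rfl rfl
  simp only [dirs, hs, Matrix.cons_val_one, Matrix.cons_val_zero, Matrix.cons_val] at h5 h6
  have c5 : k ∈ ({0, 3, 4, 6, 7} : Finset (Fin 8)) → (_root_.dW k X (0, realPoint u)).1 = 0 := by
    intro hk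
    rw [(hX.dW 1).dW_five hk, (hX.dW 2).dW_five hk] at h5
    simpa using h5.symm
  have c6 : k ∈ ({0, 1, 2, 5} : Finset (Fin 8)) → (_root_.dW k X (0, realPoint u)).1 = 0 := by
    intro hk
    rw [(hX.dW 3).dW_six hk, (hX.dW 4).dW_six hk] at h6
    simpa using h6.symm
  fin_cases k
  exacts [c5 (by simp), c6 (by simp), c6 (by simp), c5 (by simp), c5 (by simp), c6 (by simp),
    c5 (by simp), c5 (by simp)]

theorem dirs_conj_dW_fst (hX : IsAutNear X u) :
    (fun j => conj (_root_.dW j X (0, realPoint u)).1) = 0 := by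
  funext j
  rw [hX.dW_fst, map_zero, Pi.zero_apply]

theorem dirs_zero (i : Fin 4) : dirs 0 i = 0 := by
  fin_cases i <;> simp [dirs]

/-- With ∂_j Z = 0 the z²-coefficient of Z vanishes, and (∂_6 − i∂_7)W^3 is a multiple of it. -/
theorem dW_three (hX : IsAutNear X u) {k : Fin 8} (hk : k ∈ ({6, 7} : Finset (Fin 8))) :
    (_root_.dW k X (0, realPoint u)).2 3 = 0 := by
  obtain ⟨⟨-, -, -, h3⟩, -, -, h1, -⟩ :=
    hX.coeffs rfl rfl rfl rfl hX.dirs_conj_dW_fst.symm rfl rfl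
  simp only [dirs_zero, mul_zero, add_zero, sub_zero] at h1 h3
  have h1' := (mul_eq_zero.1 h1).resolve_left (by norm_num)
  rw [h1', mul_zero] at h3
  have h := eq_zero_of_sub_I_mul (hX.dW_im 6 3) (hX.dW_im 7 3) h3
  fin_cases hk
  exacts [h.1, h.2]

/-- Writing a = ∂_z Z, the relations read (∂_6 − i∂_7)W^6 = 4a + ā and (∂_3 − i∂_4)W^3 = 3a + ā.
Applied to ∂_k X, the first has zero left side for k ≤ 5, the second for k = 6, 7, and either forces
a = 0. -/
theorem fderiv_dW_fst (hX : IsAutNear X u) (k : Fin 8) :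
    (fderiv ℂ (_root_.dW k X) (0, realPoint u) (1, 0)).1 = 0 := by
  have hs := fun j => dW_comm hX.analyticAt j k
  have hlin := (hX.dW k).conj_linear_coeff
  obtain ⟨⟨-, -, h3, -⟩, -, ⟨-, -, -, h6⟩, -⟩ := (hX.dW k).coeffs rfl rfl rfl rfl rfl rfl rfl
  have hd : ∀ G : Fin 8 → ℂ, dirs G 0 = G 0 := fun _ => rfl
  rw [hd, ← hlin, add_sub_cancel_right] at h3 h6
  simp only [dirs, hs, Matrix.cons_val] at h3 h6
  -- ∂_3 W^6 and ∂_4 W^6 need not vanish, but (∂_3 − i∂_4)W^6 = 4Z applied to ∂_j X has right side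
  -- 4∂_j Z = 0.
  have hc6 : ∀ j i, i ∈ ({3, 4} : Finset (Fin 8)) →
      (_root_.dW i (_root_.dW j X) (0, realPoint u)).2 6 = 0 := by
    intro j i hi
    obtain ⟨-, -, ⟨-, -, h, -⟩, -⟩ := (hX.dW j).coeffs rfl rfl rfl rfl rfl rfl rfl
    rw [hX.dW_fst, mul_zero] at h
    have h' := eq_zero_of_sub_I_mul ((hX.dW j).dW_im 3 6) ((hX.dW j).dW_im 4 6) h
    fin_cases hi
    exacts [h'.1, h'.2]
  have c6 : (∀ j, (_root_.dW k (_root_.dW j X) (0, realPoint u)).2 6 = 0) →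
      (fderiv ℂ (_root_.dW k X) (0, realPoint u) (1, 0)).1 = 0 := by
    intro h
    rw [h 6, h 7] at h6
    refine eq_zero_of_smul_add_conj (r := 4) (by norm_num) ?_
    push_cast
    linear_combination -h6
  have c3 : (∀ j, (_root_.dW k (_root_.dW j X) (0, realPoint u)).2 3 = 0) →
      (fderiv ℂ (_root_.dW k X) (0, realPoint u) (1, 0)).1 = 0 := by
    intro h
    rw [h 3, h 4] at h3
    refine eq_zero_of_smul_add_conj (r := 3) (by norm_num) ?_
    push_cast
    linear_combination -h3
  fin_cases k
  exacts [c6 fun j => (hX.dW j).dW_six (by simp), c6 fun j => (hX.dW j).dW_six (by simp),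
    c6 fun j => (hX.dW j).dW_six (by simp), c6 fun j => hc6 j _ (by simp),
    c6 fun j => hc6 j _ (by simp), c6 fun j => (hX.dW j).dW_six (by simp),
    c3 fun j => (hX.dW j).dW_three (by simp), c3 fun j => (hX.dW j).dW_three (by simp)]

/-- The coefficient of `∂_z` is affine in `z`. -/
theorem fst_affine (hX : IsAutNear X u) : ∀ᶠ z in 𝓝 (0 : ℂ), (X (z, realPoint u)).1 =
    (X (0, realPoint u)).1 + (fderiv ℂ X (0, realPoint u) (1, 0)).1 * z := by
  have hlin := hX.conj_linear_coeff
  obtain ⟨-, -, -, h1, h2, h3, -⟩ :=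
    hX.coeffs rfl rfl rfl rfl hX.dirs_conj_dW_fst.symm rfl rfl
  simp only [dirs_zero, mul_zero, add_zero, mul_eq_zero, OfNat.ofNat_ne_zero, false_or]
    at h1 h2 h3
  have hd : ∀ G : Fin 8 → ℂ, dirs G 0 = G 0 := fun _ => rfl
  filter_upwards [hX.fst_eq rfl hX.dirs_conj_dW_fst.symm rfl] with z hz
  rw [hz, h1, h2, h3, hd, ← hlin]
  simp only [dirs_zero]
  ring

/-- Z(0, v) and ∂_z Z(0, v) have vanishing w-derivatives at real v, so both stay zero near u;
affinity in z and extension from real slices do the rest. -/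
theorem fst_eventually_eq_zero (hX : IsAutNear X u) (h0 : (X (0, realPoint u)).1 = 0)
    (h1 : (fderiv ℂ X (0, realPoint u) (1, 0)).1 = 0) :
    ∀ᶠ q in 𝓝 ((0, realPoint u) : C9), (X q).1 = 0 := by
  have e0 := eventually_eq_zero_of_fderiv_eq_zero (h := fun q => (X q).1)
    (analyticAt_fst_apply hX.analyticAt) h0 (hX.eventually.mono fun v hv k => by
      rw [fderiv_fst_apply hv.analyticAt]
      exact hv.dW_fst k)
  have e1 := eventually_eq_zero_of_fderiv_eq_zero (h := fun q => (fderiv ℂ X q (1, 0)).1)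
    (analyticAt_fst_apply (analyticAt_fderiv_apply hX.analyticAt _)) h1
    (hX.eventually.mono fun v hv k => by
      rw [fderiv_fst_apply (analyticAt_fderiv_apply hv.analyticAt _),
        fderiv_fderiv_apply_comm hv.analyticAt]
      exact hv.fderiv_dW_fst k)
  refine eventually_eq_zero_of_real_slices (analyticAt_fst_apply hX.analyticAt) ?_
  filter_upwards [hX.eventually, e0, e1] with v hv h0 h1
  filter_upwards [hv.fst_affine] with z hz
  rw [hz, h0, h1]
  ring

/-- With Z = 0 the right side of the linear relation vanishes, which kills every derivative except
that in direction 5. Since W^l no longer depends on z, tangency makes its imaginary part zero on the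
diagonal curve, and the ε⁴ limit kills the last one. -/
theorem dW_snd_eq_zero (hX : IsAutNear X u)
    (hz : ∀ᶠ q in 𝓝 ((0, realPoint u) : C9), (X q).1 = 0) (j l : Fin 8) :
    (_root_.dW j X (0, realPoint u)).2 l = 0 := by
  have hfd : ∀ v, (fderiv ℂ X (0, realPoint u) v).1 = 0 := by
    intro v
    rw [← fderiv_fst_apply hX.analyticAt,
      Filter.EventuallyEq.fderiv_eq (f := fun _ => (0 : ℂ)) hz]
    simp
  have hB : ∀ j, (_root_.dW j X (0, realPoint u)).1 = 0 := fun j => hfd _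
  have ht : Tendsto (fun z : ℂ => ((z, realPoint u) : C9)) (𝓝 0) (𝓝 (0, realPoint u)) :=
    Continuous.tendsto' (by fun_prop) _ _ rfl
  set F : Fin 8 → ℂ := fun j => (_root_.dW j X (0, realPoint u)).2 l with hF
  have hc := coeff_eq_zero_of_eventually (a := ![0, dirs F 0, dirs F 1, dirs F 2, dirs F 3]) (by
    filter_upwards [hX.linear_relation l, ht.eventually hz] with z h1 h2
    have e := sum_linXi_mul z F
    simp only [hF] at e
    rw [e, h2, hz.self_of_nhds, hfd] at h1
    simp only [hB, map_zero, mul_zero, Finset.sum_const_zero, sub_zero, add_zero] at h1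
    have h3 := (mul_eq_zero.1 h1).resolve_left (by simp)
    simp [Fin.sum_univ_succ]
    linear_combination h3)
  have him : ∀ j, (F j).im = 0 := fun j => hX.dW_im j l
  have d0 : F 0 = 0 := hc 1
  have d1 := eq_zero_of_sub_I_mul (him 1) (him 2) (hc 2)
  have d2 := eq_zero_of_sub_I_mul (him 3) (him 4) (hc 3)
  have d3 := eq_zero_of_sub_I_mul (him 6) (him 7) (hc 4)
  have hs : AnalyticAt ℂ (fun q : C9 => ((0, q.2) : C9)) (0, realPoint u) :=
    analyticAt_const.prod analyticAt_snd
  have hnear := eventually_eq_zero_of_real_slices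
    (h := fun q => (X q).2 l - (X (0, q.2)).2 l) (u := u)
    ((analyticAt_snd_apply hX.analyticAt l).fun_sub (analyticAt_snd_apply
      (AnalyticAt.fun_comp (g := X) (f := fun q : C9 => ((0, q.2) : C9)) hX.analyticAt hs) l)) (by
      have ht : Tendsto (fun v : Fin 8 → ℝ => ((0, realPoint v) : C9)) (𝓝 u)
          (𝓝 (0, realPoint u)) := (continuous_const.prodMk continuous_realPoint).tendsto u
      filter_upwards [hX.eventually, ht.eventually hz] with v hv h0
      filter_upwards [hv.snd_eq l] with z h1
      rw [h1, h0]
      simp)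
  have hpt : Tendsto (fun ε : ℝ => polarPoint u ((ε : ℂ), (ε : ℂ))) (𝓝[≠] 0)
      (𝓝 (0, realPoint u)) := (tendsto_diag_point u).mono_left nhdsWithin_le_nhds
  have hlim := hX.tendsto_im_diag l d0 d1.1
  have d5 : F 5 = 0 := by
    have he := tendsto_nhds_unique (hlim.congr' ?_)
      (tendsto_const_nhds : Tendsto (fun _ : ℝ => (0 : ℝ)) (𝓝[≠] 0) (𝓝 0))
    · change (2 * F 3 + F 5).re = 0 at he
      rw [d2.1, mul_zero, zero_add] at he
      exact Complex.ext he (him 5)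
    · filter_upwards [nhdsWithin_le_nhds (hX.polarCoeff_diag_im l), hpt.eventually hz,
        hpt.eventually hnear] with ε h1 h2 h3
      rw [polarCoeff, h2, mul_zero, sub_zero, sub_eq_zero.1 h3, polarPoint_diag] at h1
      rw [h1, zero_div]
  change F j = 0
  fin_cases j
  exacts [d0, d1.1, d1.2, d2.1, d2.2, d5, d3.1, d3.2]

/-- Infinitesimal automorphisms are determined by their value and the derivative `∂_z Z` at
a point. -/
theorem eventually_eq_zero (hX : IsAutNear X u) (h0 : X (0, realPoint u) = 0)
    (h1 : (fderiv ℂ X (0, realPoint u) (1, 0)).1 = 0) :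
    ∀ᶠ q in 𝓝 ((0, realPoint u) : C9), X q = 0 := by
  have hz := hX.fst_eventually_eq_zero (by rw [h0]; rfl) h1
  have ht : Tendsto (fun v : Fin 8 → ℝ => ((0, realPoint v) : C9)) (𝓝 u)
      (𝓝 (0, realPoint u)) := (continuous_const.prodMk continuous_realPoint).tendsto u
  have hw : ∀ l, ∀ᶠ q in 𝓝 ((0, realPoint u) : C9), (X q).2 l = 0 := by
    intro l
    have e := eventually_eq_zero_of_fderiv_eq_zero (h := fun q => (X q).2 l)
      (analyticAt_snd_apply hX.analyticAt l) (by rw [h0]; rfl) (by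
        filter_upwards [hX.eventually, ht.eventually hz.eventually_nhds] with v hv h2 k
        rw [fderiv_snd_apply hv.analyticAt]
        exact hv.dW_snd_eq_zero h2 k l)
    refine eventually_eq_zero_of_real_slices (analyticAt_snd_apply hX.analyticAt l) ?_
    filter_upwards [hX.eventually, e, ht.eventually hz] with v hv h2 h3
    filter_upwards [hv.snd_eq l] with z h4
    rw [h4, h2, h3]
    simp
  filter_upwards [hz, eventually_all.2 hw] with q h2 h3
  exact Prod.ext h2 (funext h3)

end IsAutNear

/-! ### The explicit fields -/

/-- The derivative of `fieldX i` at `q` in the direction `v`. -/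
noncomputable def fieldDeriv (q v : C9) : Fin 12 → C9 :=
  ![0, 0, 0, 0, 0, 0, 0, 0,
    (v.1, ![2 * v.2 0, 3 * v.2 1, 3 * v.2 2, 4 * v.2 3, 4 * v.2 4, 4 * v.2 5, 5 * v.2 6,
      5 * v.2 7]),
    (Complex.I * v.1, ![0, -v.2 2, v.2 1, -2 * v.2 4, 2 * v.2 3, 0, -3 * v.2 7, 3 * v.2 6]),
    (0,
      ![2 * Complex.I * v.1,
        4 * v.2 0 + 4 * Complex.I * q.1 * v.1,
        4 * q.1 * v.1,
        3 * v.2 1 + 6 * Complex.I * q.1 ^ 2 * v.1,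
        3 * v.2 2 + 6 * q.1 ^ 2 * v.1,
        2 * v.2 1,
        4 * v.2 3 + 8 * Complex.I * q.1 ^ 3 * v.1,
        4 * v.2 4 + 8 * q.1 ^ 3 * v.1]),
    (0,
      ![2 * v.1,
        4 * q.1 * v.1,
        4 * v.2 0 - 4 * Complex.I * q.1 * v.1,
        -3 * v.2 2 + 6 * q.1 ^ 2 * v.1,
        3 * v.2 1 - 6 * Complex.I * q.1 ^ 2 * v.1,
        2 * v.2 2,
        -4 * v.2 4 + 8 * q.1 ^ 3 * v.1,
        4 * v.2 3 - 8 * Complex.I * q.1 ^ 3 * v.1])]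

theorem contDiff_fieldX (i : Fin 12) : ContDiff ℂ ⊤ (fieldX i) := by
  fin_cases i
  iterate 8 exact contDiff_const
  · refine ContDiff.prodMk contDiff_fst (contDiff_pi.2 fun l => ?_)
    fin_cases l <;> simp <;> fun_prop
  · refine ContDiff.prodMk (contDiff_const.mul contDiff_fst) (contDiff_pi.2 fun l => ?_)
    fin_cases l <;> simp <;> fun_prop
  all_goals
    refine ContDiff.prodMk contDiff_const (contDiff_pi.2 fun l => ?_)
    fin_cases l <;> simp <;> fun_prop

theorem analyticAt_fieldX (i : Fin 12) (q : C9) : AnalyticAt ℂ (fieldX i) q :=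
  ((contDiff_fieldX i).contDiffAt).analyticAt

theorem fderiv_fieldX (i : Fin 12) (q v : C9) : fderiv ℂ (fieldX i) q v = fieldDeriv q v i := by
  have hd : HasFDerivAt (fieldX i) (fderiv ℂ (fieldX i) q) (q + (0 : ℂ) • v) := by
    rw [zero_smul, add_zero]
    exact (analyticAt_fieldX i q).differentiableAt.hasFDerivAt
  have hline : HasDerivAt (fun t : ℂ => q + t • v) v 0 := by
    have h := ((hasDerivAt_id (0 : ℂ)).smul_const v).const_add q
    rw [one_smul] at h
    exact h
  have h1 : HasDerivAt (fun t : ℂ => fieldX i (q + t • v)) (fderiv ℂ (fieldX i) q v) 0 :=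
    HasFDerivAt.comp_hasDerivAt (l := fieldX i) (f := fun t : ℂ => q + t • v) (0 : ℂ) hd hline
  refine h1.unique ?_
  have hz : HasDerivAt (fun t : ℂ => q.1 + t * v.1) v.1 0 := hline.fst
  have hw : ∀ j, HasDerivAt (fun t : ℂ => q.2 j + t * v.2 j) (v.2 j) 0 := fun j =>
    (hasDerivAt_pi.1 hline.snd) j
  have hm : ∀ (a b : ℂ) (j : Fin 8) (m : ℕ), HasDerivAt
      (fun t : ℂ => a * (q.2 j + t * v.2 j) + b * (q.1 + t * v.1) ^ m)
      (a * v.2 j + b * (m * q.1 ^ (m - 1) * v.1)) 0 := by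
    intro a b j m
    have h := ((hw j).const_mul a).fun_add ((hz.fun_pow m).const_mul b)
    simpa using h
  -- Every w-component of the nonconstant fields has the form a w^j + b z^m, so one derivative
  -- formula covers them all.
  have key : ∀ (a b : ℂ) (j : Fin 8) (m : ℕ) (f : ℂ → ℂ) (f' : ℂ),
      (∀ t, f t = a * (q.2 j + t * v.2 j) + b * (q.1 + t * v.1) ^ m) →
      f' = a * v.2 j + b * (m * q.1 ^ (m - 1) * v.1) → HasDerivAt f f' 0 := by
    intro a b j m f f' h h'
    rw [h', funext h]
    exact hm a b j m
  fin_cases i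
  iterate 8 exact hasDerivAt_const _ _
  · refine HasDerivAt.prodMk hz (hasDerivAt_pi.2 fun l => ?_)
    fin_cases l
    · refine key 2 0 0 0 _ _ (fun t => ?_) ?_ <;> simp
    · refine key 3 0 1 0 _ _ (fun t => ?_) ?_ <;> simp
    · refine key 3 0 2 0 _ _ (fun t => ?_) ?_ <;> simp
    · refine key 4 0 3 0 _ _ (fun t => ?_) ?_ <;> simp
    · refine key 4 0 4 0 _ _ (fun t => ?_) ?_ <;> simp
    · refine key 4 0 5 0 _ _ (fun t => ?_) ?_ <;> simp
    · refine key 5 0 6 0 _ _ (fun t => ?_) ?_ <;> simp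
    · refine key 5 0 7 0 _ _ (fun t => ?_) ?_ <;> simp
  · refine HasDerivAt.prodMk (hz.const_mul Complex.I) (hasDerivAt_pi.2 fun l => ?_)
    fin_cases l
    · refine key 0 0 0 0 _ _ (fun t => ?_) ?_ <;> simp
    · refine key (-1) 0 2 0 _ _ (fun t => ?_) ?_ <;> simp
    · refine key 1 0 1 0 _ _ (fun t => ?_) ?_ <;> simp
    · refine key (-2) 0 4 0 _ _ (fun t => ?_) ?_ <;> simp
    · refine key 2 0 3 0 _ _ (fun t => ?_) ?_ <;> simp
    · refine key 0 0 0 0 _ _ (fun t => ?_) ?_ <;> simp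
    · refine key (-3) 0 7 0 _ _ (fun t => ?_) ?_ <;> simp
    · refine key 3 0 6 0 _ _ (fun t => ?_) ?_ <;> simp
  · refine HasDerivAt.prodMk (hasDerivAt_const _ _) (hasDerivAt_pi.2 fun l => ?_)
    fin_cases l
    · refine key 0 (2 * Complex.I) 0 1 _ _ (fun t => ?_) ?_ <;> simp
    · refine key 4 (2 * Complex.I) 0 2 _ _ (fun t => ?_) ?_ <;> simp; ring
    · refine key 0 2 0 2 _ _ (fun t => ?_) ?_ <;> simp; ring
    · refine key 3 (2 * Complex.I) 1 3 _ _ (fun t => ?_) ?_ <;> simp; ring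
    · refine key 3 2 2 3 _ _ (fun t => ?_) ?_ <;> simp; ring
    · refine key 2 0 1 0 _ _ (fun t => ?_) ?_ <;> simp
    · refine key 4 (2 * Complex.I) 3 4 _ _ (fun t => ?_) ?_ <;> simp; ring
    · refine key 4 2 4 4 _ _ (fun t => ?_) ?_ <;> simp; ring
  · refine HasDerivAt.prodMk (hasDerivAt_const _ _) (hasDerivAt_pi.2 fun l => ?_)
    fin_cases l
    · refine key 0 2 0 1 _ _ (fun t => ?_) ?_ <;> simp
    · refine key 0 2 0 2 _ _ (fun t => ?_) ?_ <;> simp; ring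
    · refine key 4 (-2 * Complex.I) 0 2 _ _ (fun t => ?_) ?_ <;> simp <;> ring
    · refine key (-3) 2 2 3 _ _ (fun t => ?_) ?_ <;> simp; ring
    · refine key 3 (-2 * Complex.I) 1 3 _ _ (fun t => ?_) ?_ <;> simp <;> ring
    · refine key 2 0 2 0 _ _ (fun t => ?_) ?_ <;> simp
    · refine key (-4) 2 4 4 _ _ (fun t => ?_) ?_ <;> simp; ring
    · refine key 4 (-2 * Complex.I) 3 4 _ _ (fun t => ?_) ?_ <;> simp <;> ring

theorem isTangentAt_fieldX (i : Fin 12) {q : C9} (hq : q ∈ M1) : IsTangentAt (fieldX i) q := by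
  rw [isTangentAt_iff]
  intro l
  -- The defining equations eliminate w̄, and tangency becomes a polynomial identity in z, z̄ and w.
  have hw : ∀ j, conj (q.2 j) = q.2 j - XiC q.1 (conj q.1) j := by
    intro j
    have h : q.2 j - conj (q.2 j) - XiC q.1 (conj q.1) j = 0 := hq j
    linear_combination -h
  rw [← Complex.conj_eq_iff_im]
  have hI : Complex.I ^ 2 = -1 := Complex.I_sq
  fin_cases i
  iterate 8
    simp [fieldX, fieldValues, Pi.single_apply, apply_ite conj]
  all_goals
    fin_cases l <;>
    simp [fieldX, fieldValues, XiZ, XiC, hw, Complex.conj_ofNat] <;>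
    grind

/-! ### Commutators of the explicit fields. -/

theorem lieBracket_fieldX (i j : Fin 12) (q : C9) : VectorField.lieBracket ℂ (fieldX i) (fieldX j) q =
    fieldDeriv q (fieldX i q) j - fieldDeriv q (fieldX j q) i := by
  rw [VectorField.lieBracket, fderiv_fieldX, fderiv_fieldX]

theorem prod_pi_ext {a b : C9} (h0 : a.1 = b.1) (h : ∀ l, a.2 l = b.2 l) : a = b :=
  Prod.ext h0 (funext h)

@[simp]
theorem fieldX_0 (q : C9) : fieldX 0 q = (0, Pi.single 0 1) := rfl

@[simp]
theorem fieldX_1 (q : C9) : fieldX 1 q = (0, Pi.single 1 1) := rfl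

@[simp]
theorem fieldX_2 (q : C9) : fieldX 2 q = (0, Pi.single 2 1) := rfl

@[simp]
theorem fieldX_3 (q : C9) : fieldX 3 q = (0, Pi.single 3 1) := rfl

@[simp]
theorem fieldX_4 (q : C9) : fieldX 4 q = (0, Pi.single 4 1) := rfl

@[simp]
theorem fieldX_5 (q : C9) : fieldX 5 q = (0, Pi.single 5 1) := rfl

@[simp]
theorem fieldX_6 (q : C9) : fieldX 6 q = (0, Pi.single 6 1) := rfl

@[simp]
theorem fieldX_7 (q : C9) : fieldX 7 q = (0, Pi.single 7 1) := rfl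

@[simp]
theorem fieldX_8 (q : C9) : fieldX 8 q = (q.1, ![2 * q.2 0, 3 * q.2 1, 3 * q.2 2, 4 * q.2 3,
    4 * q.2 4, 4 * q.2 5, 5 * q.2 6, 5 * q.2 7]) := rfl

@[simp]
theorem fieldX_9 (q : C9) : fieldX 9 q = (Complex.I * q.1,
    ![0, -q.2 2, q.2 1, -2 * q.2 4, 2 * q.2 3, 0, -3 * q.2 7, 3 * q.2 6]) := rfl

@[simp]
theorem fieldX_10 (q : C9) : fieldX 10 q = (1,
    ![2 * Complex.I * q.1, 4 * q.2 0 + 2 * Complex.I * q.1 ^ 2, 2 * q.1 ^ 2,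
      3 * q.2 1 + 2 * Complex.I * q.1 ^ 3, 3 * q.2 2 + 2 * q.1 ^ 3, 2 * q.2 1,
      4 * q.2 3 + 2 * Complex.I * q.1 ^ 4, 4 * q.2 4 + 2 * q.1 ^ 4]) := rfl

@[simp]
theorem fieldX_11 (q : C9) : fieldX 11 q = (Complex.I,
    ![2 * q.1, 2 * q.1 ^ 2, 4 * q.2 0 - 2 * Complex.I * q.1 ^ 2, -3 * q.2 2 + 2 * q.1 ^ 3,
      3 * q.2 1 - 2 * Complex.I * q.1 ^ 3, 2 * q.2 2, -4 * q.2 4 + 2 * q.1 ^ 4,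
      4 * q.2 3 - 2 * Complex.I * q.1 ^ 4]) := rfl

@[simp]
theorem fieldDeriv_0 (q v : C9) : fieldDeriv q v 0 = 0 := rfl

@[simp]
theorem fieldDeriv_1 (q v : C9) : fieldDeriv q v 1 = 0 := rfl

@[simp]
theorem fieldDeriv_2 (q v : C9) : fieldDeriv q v 2 = 0 := rfl

@[simp]
theorem fieldDeriv_3 (q v : C9) : fieldDeriv q v 3 = 0 := rfl

@[simp]
theorem fieldDeriv_4 (q v : C9) : fieldDeriv q v 4 = 0 := rfl

@[simp]
theorem fieldDeriv_5 (q v : C9) : fieldDeriv q v 5 = 0 := rfl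

@[simp]
theorem fieldDeriv_6 (q v : C9) : fieldDeriv q v 6 = 0 := rfl

@[simp]
theorem fieldDeriv_7 (q v : C9) : fieldDeriv q v 7 = 0 := rfl

@[simp]
theorem fieldDeriv_8 (q v : C9) : fieldDeriv q v 8 = (v.1, ![2 * v.2 0, 3 * v.2 1, 3 * v.2 2,
    4 * v.2 3, 4 * v.2 4, 4 * v.2 5, 5 * v.2 6, 5 * v.2 7]) := rfl

@[simp]
theorem fieldDeriv_9 (q v : C9) : fieldDeriv q v 9 = (Complex.I * v.1,
    ![0, -v.2 2, v.2 1, -2 * v.2 4, 2 * v.2 3, 0, -3 * v.2 7, 3 * v.2 6]) := rfl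

@[simp]
theorem fieldDeriv_10 (q v : C9) : fieldDeriv q v 10 = (0,
    ![2 * Complex.I * v.1, 4 * v.2 0 + 4 * Complex.I * q.1 * v.1, 4 * q.1 * v.1,
      3 * v.2 1 + 6 * Complex.I * q.1 ^ 2 * v.1, 3 * v.2 2 + 6 * q.1 ^ 2 * v.1, 2 * v.2 1,
      4 * v.2 3 + 8 * Complex.I * q.1 ^ 3 * v.1, 4 * v.2 4 + 8 * q.1 ^ 3 * v.1]) := rfl

@[simp]
theorem fieldDeriv_11 (q v : C9) : fieldDeriv q v 11 = (0,
    ![2 * v.1, 4 * q.1 * v.1, 4 * v.2 0 - 4 * Complex.I * q.1 * v.1,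
      -3 * v.2 2 + 6 * q.1 ^ 2 * v.1, 3 * v.2 1 - 6 * Complex.I * q.1 ^ 2 * v.1, 2 * v.2 2,
      -4 * v.2 4 + 8 * q.1 ^ 3 * v.1, 4 * v.2 3 - 8 * Complex.I * q.1 ^ 3 * v.1]) := rfl

/-- The bracket of the fields `fieldX i` and `fieldX j`. -/
noncomputable def fieldLie (i j : Fin 12) : C9 → C9 :=
  VectorField.lieBracket ℂ (fieldX i) (fieldX j)

theorem fieldLie_ext {i j : Fin 12} {R : C9 → C9}
    (h0 : ∀ q, (fieldDeriv q (fieldX i q) j).1 - (fieldDeriv q (fieldX j q) i).1 = (R q).1)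
    (h : ∀ q l, (fieldDeriv q (fieldX i q) j).2 l - (fieldDeriv q (fieldX j q) i).2 l =
      (R q).2 l) : fieldLie i j = R := by
  funext q
  rw [fieldLie, lieBracket_fieldX]
  exact Prod.ext (h0 q) (funext (h q))

theorem fieldLie_const_eight :
    fieldLie 0 8 = (2 : ℝ) • fieldX 0 ∧
    fieldLie 1 8 = (3 : ℝ) • fieldX 1 ∧
    fieldLie 2 8 = (3 : ℝ) • fieldX 2 ∧
    fieldLie 3 8 = (4 : ℝ) • fieldX 3 ∧
    fieldLie 4 8 = (4 : ℝ) • fieldX 4 ∧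
    fieldLie 5 8 = (4 : ℝ) • fieldX 5 ∧
    fieldLie 6 8 = (5 : ℝ) • fieldX 6 ∧
    fieldLie 7 8 = (5 : ℝ) • fieldX 7 := by
  have hI : Complex.I ^ 2 = -1 := Complex.I_sq
  refine ⟨?_, ?_, ?_, ?_, ?_, ?_, ?_, ?_⟩
  all_goals
    refine fieldLie_ext ?_ fun q l => ?_
    · intro q
      simp
      try grind
    · fin_cases l <;> simp

theorem fieldLie_const_nine :
    fieldLie 0 9 = 0 ∧
    fieldLie 1 9 = fieldX 2 ∧
    fieldLie 2 9 = -fieldX 1 ∧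
    fieldLie 3 9 = (2 : ℝ) • fieldX 4 ∧
    fieldLie 4 9 = (-2 : ℝ) • fieldX 3 ∧
    fieldLie 5 9 = 0 ∧
    fieldLie 6 9 = (3 : ℝ) • fieldX 7 ∧
    fieldLie 7 9 = (-3 : ℝ) • fieldX 6 := by
  have hI : Complex.I ^ 2 = -1 := Complex.I_sq
  refine ⟨?_, ?_, ?_, ?_, ?_, ?_, ?_, ?_⟩
  all_goals
    refine fieldLie_ext ?_ fun q l => ?_
    · intro q
      simp
      try grind
    · fin_cases l <;> simp

theorem fieldLie_const_ten :
    fieldLie 0 10 = (4 : ℝ) • fieldX 1 ∧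
    fieldLie 1 10 = (3 : ℝ) • fieldX 3 + (2 : ℝ) • fieldX 5 ∧
    fieldLie 2 10 = (3 : ℝ) • fieldX 4 ∧
    fieldLie 3 10 = (4 : ℝ) • fieldX 6 ∧
    fieldLie 4 10 = (4 : ℝ) • fieldX 7 ∧
    fieldLie 5 10 = 0 ∧
    fieldLie 6 10 = 0 ∧
    fieldLie 7 10 = 0 := by
  have hI : Complex.I ^ 2 = -1 := Complex.I_sq
  refine ⟨?_, ?_, ?_, ?_, ?_, ?_, ?_, ?_⟩
  all_goals
    refine fieldLie_ext ?_ fun q l => ?_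
    · intro q
      simp
      try grind
    · fin_cases l <;> simp

theorem fieldLie_const_eleven :
    fieldLie 0 11 = (4 : ℝ) • fieldX 2 ∧
    fieldLie 1 11 = (3 : ℝ) • fieldX 4 ∧
    fieldLie 2 11 = (-3 : ℝ) • fieldX 3 + (2 : ℝ) • fieldX 5 ∧
    fieldLie 3 11 = (4 : ℝ) • fieldX 7 ∧
    fieldLie 4 11 = (-4 : ℝ) • fieldX 6 ∧
    fieldLie 5 11 = 0 ∧
    fieldLie 6 11 = 0 ∧
    fieldLie 7 11 = 0 := by
  have hI : Complex.I ^ 2 = -1 := Complex.I_sq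
  refine ⟨?_, ?_, ?_, ?_, ?_, ?_, ?_, ?_⟩
  all_goals
    refine fieldLie_ext ?_ fun q l => ?_
    · intro q
      simp
      try grind
    · fin_cases l <;> simp

theorem fieldLie_nonconst :
    fieldLie 8 9 = 0 ∧
    fieldLie 8 10 = -fieldX 10 ∧
    fieldLie 8 11 = -fieldX 11 ∧
    fieldLie 9 10 = -fieldX 11 ∧
    fieldLie 9 11 = fieldX 10 ∧
    fieldLie 10 11 = (4 : ℝ) • fieldX 0 := by
  have hI : Complex.I ^ 2 = -1 := Complex.I_sq
  refine ⟨?_, ?_, ?_, ?_, ?_, ?_⟩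
  all_goals
    refine fieldLie_ext ?_ fun q l => ?_
    · intro q
      simp
      try grind
    · fin_cases l <;> simp <;> grind

theorem fieldLie_of_lt_eight {i j : Fin 12} (hi : i < 8) (hj : j < 8) : fieldLie i j = 0 := by
  have h : ∀ k : Fin 12, k < 8 → ∀ q v, fieldDeriv q v k = 0 := by
    intro k hk q v
    fin_cases k <;> first | rfl | exact absurd hk (by decide)
  refine fieldLie_ext (fun q => ?_) fun q l => ?_ <;> simp [h i hi, h j hj]

theorem fieldLie_self (i : Fin 12) : fieldLie i i = 0 := VectorField.lieBracket_self

theorem lieBracket_fieldX_eq_commTable {i j : Fin 12} (h : i ≤ j) :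
    VectorField.lieBracket ℂ (fieldX i) (fieldX j) = commTable fieldX i j := by
  change fieldLie i j = _
  obtain ⟨a0, a1, a2, a3, a4, a5, a6, a7⟩ := fieldLie_const_eight
  obtain ⟨b0, b1, b2, b3, b4, b5, b6, b7⟩ := fieldLie_const_nine
  obtain ⟨c0, c1, c2, c3, c4, c5, c6, c7⟩ := fieldLie_const_ten
  obtain ⟨d0, d1, d2, d3, d4, d5, d6, d7⟩ := fieldLie_const_eleven
  obtain ⟨e1, e2, e3, e4, e5, e6⟩ := fieldLie_nonconst
  fin_cases i <;> fin_cases j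
  all_goals first
    | exact absurd h (by decide)
    | exact fieldLie_of_lt_eight (by decide) (by decide)
    | exact fieldLie_self _
    | skip
  exacts [a0, b0, c0, d0, a1, b1, c1, d1, a2, b2, c2, d2, a3, b3, c3, d3, a4, b4, c4, d4,
    a5, b5, c5, d5, a6, b6, c6, d6, a7, b7, c7, d7, e1, e2, e3, e4, e5, e6]

/-- Table entries are linear in the family, so the table computed for functions transfers to germs
and to the Lie subalgebra. -/
theorem map_commTable {V W : Type*} [AddCommGroup V] [Module ℝ V] [AddCommGroup W] [Module ℝ W]
    (f : V →ₗ[ℝ] W) (X : Fin 12 → V) (i j : Fin 12) :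
    f (commTable X i j) = commTable (fun k => f (X k)) i j := by
  fin_cases i <;> fin_cases j <;>
    first
    | exact map_zero f
    | exact map_smul f _ _
    | exact map_neg f _
    | rfl
    | exact (map_add f _ _).trans (congrArg₂ _ (map_smul f _ _) (map_smul f _ _))

/-! ### The gradation -/

/-- The degrees of the basis fields. -/
def fieldDegree : Fin 12 → ℤ := ![-2, -3, -3, -4, -4, -4, -5, -5, 0, 0, -1, -1]

section

variable {V : Type*} [AddCommGroup V] [Module ℝ V]

/-- Indexing the generators by degree replaces the case distinction on k, so span induction runs
uniformly. -/
theorem gradedPiece_eq_span (X : Fin 12 → V) (k : ℤ) :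
    gradedPiece X k = Submodule.span ℝ (X '' {i | fieldDegree i = k}) := by
  have key : ∀ (k : ℤ) (s : Finset (Fin 12)), (∀ i, fieldDegree i = k ↔ i ∈ s) →
      X '' {i | fieldDegree i = k} = X '' (s : Set (Fin 12)) := by
    intro k s h
    congr 1
    ext i
    simpa using h i
  unfold gradedPiece
  split_ifs with h1 h2 h3 h4 h5 h6
  · rw [h1, key (-5) {6, 7} (by decide)]
    simp [Set.image_insert_eq]
  · rw [h2, key (-4) {3, 4, 5} (by decide)]
    simp [Set.image_insert_eq]
  · rw [h3, key (-3) {1, 2} (by decide)]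
    simp [Set.image_insert_eq]
  · rw [h4, key (-2) {0} (by decide)]
    simp
  · rw [h5, key (-1) {10, 11} (by decide)]
    simp [Set.image_insert_eq]
  · rw [h6, key 0 {8, 9} (by decide)]
    simp [Set.image_insert_eq]
  · have he : {i | fieldDegree i = k} = ∅ := by
      refine Set.eq_empty_of_forall_notMem fun i hi => ?_
      have hd : ∀ i, fieldDegree i ∈ ({-5, -4, -3, -2, -1, 0} : Finset ℤ) := by decide
      have hm := hd i
      rw [show fieldDegree i = k from hi] at hm
      simp [h1, h2, h3, h4, h5, h6] at hm
    rw [he, Set.image_empty, Submodule.span_empty]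

theorem mem_gradedPiece (X : Fin 12 → V) (i : Fin 12) : X i ∈ gradedPiece X (fieldDegree i) := by
  rw [gradedPiece_eq_span]
  exact Submodule.subset_span ⟨i, rfl, rfl⟩

theorem commTable_mem (X : Fin 12 → V) (i j : Fin 12) :
    commTable X i j ∈ gradedPiece X (fieldDegree i + fieldDegree j) := by
  have h : ∀ (c : ℝ) (i : Fin 12) {k : ℤ}, fieldDegree i = k → c • X i ∈ gradedPiece X k :=
    fun c i k hk => hk ▸ Submodule.smul_mem _ _ (mem_gradedPiece X i)
  have h' : ∀ (i : Fin 12) {k : ℤ}, fieldDegree i = k → X i ∈ gradedPiece X k :=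
    fun i k hk => hk ▸ mem_gradedPiece X i
  fin_cases i <;> fin_cases j <;>
    first
    | exact Submodule.zero_mem _
    | exact h _ _ (by decide)
    | exact Submodule.neg_mem _ (h' _ (by decide))
    | exact h' _ (by decide)
    | exact Submodule.add_mem _ (h _ _ (by decide)) (h _ _ (by decide))

end

section

variable {L : Type*} [LieRing L] [LieAlgebra ℝ L]

/-- By bilinearity it suffices to check generators; skew-symmetry covers the pairs below the
diagonal, where the table is only filler. -/
theorem lie_mem_gradedPiece {X : Fin 12 → L} (hb : ∀ i j, i ≤ j → ⁅X i, X j⁆ = commTable X i j)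
    {k m : ℤ} {x y : L} (hx : x ∈ gradedPiece X k) (hy : y ∈ gradedPiece X m) :
    ⁅x, y⁆ ∈ gradedPiece X (k + m) := by
  have hgen : ∀ i j, ⁅X i, X j⁆ ∈ gradedPiece X (fieldDegree i + fieldDegree j) := by
    intro i j
    rcases le_total i j with h | h
    · rw [hb i j h]
      exact commTable_mem X i j
    · rw [← lie_skew, hb j i h, add_comm]
      exact Submodule.neg_mem _ (commTable_mem X j i)
  rw [gradedPiece_eq_span] at hx hy
  refine Submodule.span_induction (p := fun x _ => ⁅x, y⁆ ∈ gradedPiece X (k + m)) ?_ ?_ ?_ ?_ hx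
  · rintro _ ⟨i, rfl, rfl⟩
    refine Submodule.span_induction
      (p := fun y _ => ⁅X i, y⁆ ∈ gradedPiece X (fieldDegree i + m)) ?_ ?_ ?_ ?_ hy
    · rintro _ ⟨j, rfl, rfl⟩
      exact hgen i j
    · rw [lie_zero]
      exact Submodule.zero_mem _
    · intro a b _ _ ha hb
      rw [lie_add]
      exact Submodule.add_mem _ ha hb
    · intro c a _ ha
      rw [lie_smul]
      exact Submodule.smul_mem _ _ ha
  · rw [zero_lie]
    exact Submodule.zero_mem _
  · intro a b _ _ ha hb
    rw [add_lie]
    exact Submodule.add_mem _ ha hb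
  · intro c a _ ha
    rw [smul_lie]
    exact Submodule.smul_mem _ _ ha

/-- The decomposition map sends each basis vector to the summand of its degree. It inverts the
summation map, as is checked on generators. -/
theorem nonempty_gradedLieAlgebra (X : Module.Basis (Fin 12) ℝ L)
    (hb : ∀ i j, i ≤ j → ⁅X i, X j⁆ = commTable X i j) :
    Nonempty (GradedLieAlgebra (gradedPiece X)) := by
  let f : L →ₗ[ℝ] DirectSum ℤ fun k => gradedPiece X k := X.constr ℝ fun i =>
    DirectSum.lof ℝ ℤ (fun k => gradedPiece X k) (fieldDegree i) ⟨X i, mem_gradedPiece X i⟩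
  have hf : ∀ i, f (X i) = DirectSum.lof ℝ ℤ (fun k => gradedPiece X k) (fieldDegree i)
      ⟨X i, mem_gradedPiece X i⟩ := fun i => X.constr_basis ℝ _ i
  have hleft : DirectSum.coeLinearMap (gradedPiece X) ∘ₗ f = .id := by
    refine X.ext fun i => ?_
    rw [LinearMap.comp_apply, hf, DirectSum.coeLinearMap_lof]
    rfl
  have hright : f ∘ₗ DirectSum.coeLinearMap (gradedPiece X) = .id := by
    refine DirectSum.linearMap_ext ℝ fun k => LinearMap.ext fun x => ?_
    rw [LinearMap.comp_apply, LinearMap.comp_apply, DirectSum.coeLinearMap_lof]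
    have key : ∀ y (hy : y ∈ gradedPiece X k),
        f y = DirectSum.lof ℝ ℤ (fun k => gradedPiece X k) k ⟨y, hy⟩ := by
      have hs := gradedPiece_eq_span X k
      intro y hy
      have hy' := hy
      rw [hs] at hy'
      revert hy
      refine Submodule.span_induction (p := fun y _ => ∀ hy : y ∈ gradedPiece X k,
        f y = DirectSum.lof ℝ ℤ (fun k => gradedPiece X k) k ⟨y, hy⟩) ?_ ?_ ?_ ?_ hy'
      · rintro _ ⟨i, rfl, rfl⟩ _
        exact hf i
      · intro h
        rw [map_zero]
        exact (map_zero _).symm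
      · intro a b ha hb iha ihb h
        rw [map_add, iha (hs ▸ ha), ihb (hs ▸ hb), ← map_add]
        rfl
      · intro c a ha iha h
        rw [map_smul, iha (hs ▸ ha), ← map_smul]
        rfl
    exact key x x.2
  exact ⟨{ DirectSum.Decomposition.ofLinearMap (gradedPiece X) f hleft hright with
    bracket_mem := fun _ _ _ _ hx hy => lie_mem_gradedPiece hb hx hy }⟩

end

/-! ### The basis of `autCR S` -/

theorem realPoint_zero : realPoint 0 = 0 := by
  funext j
  simp [realPoint]

/-- Real linear combinations of the explicit fields. -/
noncomputable def fieldComb (c : Fin 12 → ℝ) : C9 → C9 := ∑ i, c i • fieldX i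

theorem real_smul_eq (c : ℝ) (X : C9 → C9) : c • X = (c : ℂ) • X := by
  funext q
  simp

theorem analyticAt_fieldComb (c : Fin 12 → ℝ) (q : C9) : AnalyticAt ℂ (fieldComb c) q := by
  refine Finset.analyticAt_sum _ fun i _ => ?_
  rw [real_smul_eq]
  exact (analyticAt_fieldX i q).const_smul

theorem isTangentAt_fieldComb (c : Fin 12 → ℝ) {q : C9} (hq : q ∈ M1) :
    IsTangentAt (fieldComb c) q := by
  intro j
  have h : fieldComb c q = ∑ i, c i • fieldX i q := by simp [fieldComb, Finset.sum_apply]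
  rw [h, map_sum]
  exact Finset.sum_eq_zero fun i _ => by rw [map_smul, isTangentAt_fieldX i hq j, smul_zero]

/-- The value at the origin reveals ten of the twelve coefficients; the dilation and the rotation
vanish there and are detected by `fderiv_fieldComb_fst`. -/
theorem fieldComb_apply_zero (c : Fin 12 → ℝ) : fieldComb c 0 =
    (c 10 + c 11 * Complex.I, ![(c 0 : ℂ), c 1, c 2, c 3, c 4, c 5, c 6, c 7]) := by
  refine prod_pi_ext ?_ fun l => ?_
  · simp [fieldComb, Fin.sum_univ_succ]
  · fin_cases l <;>
      simp [fieldComb, Fin.sum_univ_succ, Matrix.vecHead, Matrix.vecTail, Fin.ext_iff]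

theorem fderiv_fieldComb_fst (c : Fin 12 → ℝ) :
    (fderiv ℂ (fieldComb c) 0 (1, 0)).1 = c 8 + c 9 * Complex.I := by
  have h : fieldComb c = fun q => ∑ i, (c i : ℂ) • fieldX i q := by
    funext q
    simp [fieldComb, Finset.sum_apply]
  rw [h, fderiv_fun_sum fun i _ =>
    ((analyticAt_fieldX i 0).differentiableAt.fun_const_smul (c i : ℂ))]
  have h' : ∀ i, fderiv ℂ (fun q => (c i : ℂ) • fieldX i q) 0 (1, 0) =
      (c i : ℂ) • fieldDeriv 0 (1, 0) i := by
    intro i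
    rw [fderiv_fun_const_smul (analyticAt_fieldX i 0).differentiableAt, ← fderiv_fieldX]
    rfl
  rw [_root_.sum_apply]
  simp only [h']
  simp [Fin.sum_univ_succ]

theorem fieldComb_coeffs_eq_zero {c : Fin 12 → ℝ} (h0 : fieldComb c 0 = 0)
    (h1 : (fderiv ℂ (fieldComb c) 0 (1, 0)).1 = 0) : c = 0 := by
  rw [fieldComb_apply_zero] at h0
  rw [fderiv_fieldComb_fst] at h1
  have e : ∀ a b : ℝ, (a : ℂ) + b * Complex.I = 0 → a = 0 ∧ b = 0 := by
    intro a b h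
    have h2 := congrArg Complex.re h
    have h3 := congrArg Complex.im h
    simp at h2 h3
    exact ⟨h2, h3⟩
  have hz := e _ _ (congrArg Prod.fst h0)
  have ha := e _ _ h1
  have hw := fun l => congrFun (congrArg Prod.snd h0) l
  simp [Fin.forall_fin_succ] at hw
  obtain ⟨w0, w1, w2, w3, w4, w5, w6, w7⟩ := hw
  funext i
  fin_cases i
  exacts [w0, w1, w2, w3, w4, w5, w6, w7, ha.1, ha.2, hz.1, hz.2]

/-- Near the origin an infinitesimal automorphism is a combination of the explicit fields. -/
theorem IsAutNear.exists_eq_fieldComb {X : C9 → C9} (hX : IsAutNear X 0) :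
    ∃ c, ∀ᶠ q in 𝓝 (0 : C9), X q = fieldComb c q := by
  have hp : ((0, realPoint 0) : C9) = 0 := by rw [realPoint_zero]; rfl
  have him := fun l => hX.snd_im_eq_zero l
  rw [hp] at him
  set z := (X 0).1 with hz
  set a := (fderiv ℂ X 0 (1, 0)).1 with ha
  set r := fun l => ((X 0).2 l).re with hr
  -- The coefficients match the twelve real data at the origin: W(0), which is real, then ∂_z Z(0),
  -- then Z(0).
  refine ⟨![r 0, r 1, r 2, r 3, r 4, r 5, r 6, r 7, a.re, a.im, z.re, z.im], ?_⟩
  set c : Fin 12 → ℝ := ![r 0, r 1, r 2, r 3, r 4, r 5, r 6, r 7, a.re, a.im, z.re, z.im] with hc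
  have hXa : AnalyticAt ℂ X 0 := hp ▸ hX.analyticAt
  have hY : IsAutNear (X - fieldComb c) 0 := by
    refine ⟨hX.analyticAt.sub (analyticAt_fieldComb c _), ?_⟩
    filter_upwards [hX.tangent] with q hq hm j
    rw [Pi.sub_apply, map_sub, hq hm j, isTangentAt_fieldComb c hm j, sub_zero]
  have h := hY.eventually_eq_zero ?_ ?_
  · rw [hp] at h
    exact h.mono fun q hq => sub_eq_zero.1 hq
  · rw [hp, Pi.sub_apply, fieldComb_apply_zero, sub_eq_zero]
    have hre : ∀ l, (X 0).2 l = (r l : ℂ) := fun l => Complex.ext rfl (by simp [him l])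
    refine prod_pi_ext ?_ fun l => ?_
    · exact (Complex.re_add_im z).symm
    · rw [hre]
      fin_cases l <;> rfl
  · rw [hp, fderiv_sub hXa.differentiableAt (analyticAt_fieldComb c 0).differentiableAt]
    change a - (fderiv ℂ (fieldComb c) 0 (1, 0)).1 = 0
    rw [fderiv_fieldComb_fst, sub_eq_zero]
    exact (Complex.re_add_im a).symm

/-- Identity theorem along a preconnected set. -/
theorem eventually_eq_of_isPreconnected {S : Set C9} (hS : IsPreconnected S) {f g : C9 → C9}
    (hf : AnalyticOnNhd ℂ f S) (hg : AnalyticOnNhd ℂ g S) {x : C9} (hx : x ∈ S)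
    (h : f =ᶠ[𝓝 x] g) : f =ᶠ[𝓝ˢ S] g := by
  refine eventually_nhdsSet_iff_forall.2 fun s hs => ?_
  -- The set of points near which f = g is open, and closed relative to S by the identity theorem on
  -- a ball around a limit point.
  have hsub : S ⊆ {y | ∀ᶠ q in 𝓝 y, f q = g q} := by
    refine hS.subset_of_closure_inter_subset isOpen_setOfPred_eventually_nhds ⟨x, hx, h⟩ ?_
    rintro y ⟨hy, hyS⟩
    obtain ⟨ε, hε, hb⟩ := Metric.eventually_nhds_iff_ball.1
      ((hf y hyS).eventually_analyticAt.and (hg y hyS).eventually_analyticAt)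
    obtain ⟨t, ht, hdist⟩ := Metric.mem_closure_iff.1 hy ε hε
    have htb : t ∈ Metric.ball y ε := by rwa [Metric.mem_ball, dist_comm]
    have he : Set.EqOn f g (Metric.ball y ε) :=
      AnalyticOnNhd.eqOn_of_preconnected_of_eventuallyEq (fun q hq => (hb q hq).1)
        (fun q hq => (hb q hq).2) Metric.isPreconnected_ball htb ht
    exact he.eventuallyEq_of_mem (Metric.ball_mem_nhds y hε)
  exact hsub hs

/-! ### Germs of the explicit fields: independence, spanning and brackets. -/

section

variable {S : Set C9}

/-- The germs along `S` of the explicit fields. -/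
noncomputable def fieldGerm (S : Set C9) (i : Fin 12) : autCR S :=
  ⟨⟨(fieldX i : C9 → C9), fieldX i, fun q _ => analyticAt_fieldX i q, rfl⟩, fieldX i, rfl,
    Eventually.of_forall fun _ hq => isTangentAt_fieldX i hq⟩

/-- The inclusion of `autCR S` into germs. -/
noncomputable def autCRToGerm (S : Set C9) : autCR S →ₗ[ℝ] Germ (𝓝ˢ S) C9 :=
  (holGerms S).subtype ∘ₗ (autCR S).toSubmodule.subtype

theorem autCRToGerm_injective : Function.Injective (autCRToGerm S) :=
  Subtype.val_injective.comp Subtype.val_injective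

/-- Passage to germs, as a linear map. -/
noncomputable def germLinearMap (S : Set C9) : (C9 → C9) →ₗ[ℝ] Germ (𝓝ˢ S) C9 where
  toFun f := f
  map_add' _ _ := rfl
  map_smul' _ _ := rfl

theorem autCRToGerm_fieldGerm (i : Fin 12) :
    autCRToGerm S (fieldGerm S i) = germLinearMap S (fieldX i) := rfl

theorem autCRToGerm_sum (c : Fin 12 → ℝ) :
    autCRToGerm S (∑ i, c i • fieldGerm S i) = germLinearMap S (fieldComb c) := by
  simp only [fieldComb, map_sum, map_smul, autCRToGerm_fieldGerm]

theorem linearIndependent_fieldGerm (hS0 : (0 : C9) ∈ S) :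
    LinearIndependent ℝ (fieldGerm S) := by
  refine Fintype.linearIndependent_iff.2 fun c hc => ?_
  have h := congrArg (autCRToGerm S) hc
  rw [autCRToGerm_sum, map_zero] at h
  have h' : fieldComb c =ᶠ[𝓝ˢ S] fun _ => 0 := Germ.coe_eq.1 h
  have h0 : fieldComb c =ᶠ[𝓝 0] fun _ => 0 := eventually_nhdsSet_iff_forall.1 h' 0 hS0
  have hc0 := fieldComb_coeffs_eq_zero h0.eq_of_nhds (by rw [h0.fderiv_eq]; simp)
  exact fun i => congrFun hc0 i

theorem span_fieldGerm (hS0 : (0 : C9) ∈ S) (hS : IsPreconnected S) :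
    ⊤ ≤ Submodule.span ℝ (Set.range (fieldGerm S)) := by
  rintro ⟨⟨_, X, hX, rfl⟩, X', hX', ht⟩ -
  have hp : ((0, realPoint 0) : C9) = 0 := by rw [realPoint_zero]; rfl
  -- The holomorphic and the tangent representatives of the germ may differ, but they agree near S,
  -- so tangency passes to the holomorphic one.
  have ht' : ∀ᶠ q in 𝓝ˢ S, q ∈ M1 → IsTangentAt X q := by
    filter_upwards [ht, Germ.coe_eq.1 hX'] with q h1 h2 hq j
    rw [← h2]
    exact h1 hq j
  have hloc : IsAutNear X 0 := by
    refine ⟨?_, ?_⟩ <;> rw [hp]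
    · exact hX 0 hS0
    · exact eventually_nhdsSet_iff_forall.1 ht' 0 hS0
  obtain ⟨c, hc⟩ := hloc.exists_eq_fieldComb
  have he := eventually_eq_of_isPreconnected hS hX (fun q _ => analyticAt_fieldComb c q) hS0 hc
  have hsum : (⟨⟨(X : C9 → C9), X, hX, rfl⟩, X', hX', ht⟩ : autCR S) =
      ∑ i, c i • fieldGerm S i := by
    refine autCRToGerm_injective ?_
    rw [autCRToGerm_sum]
    exact Germ.coe_eq.2 he
  rw [hsum]
  exact Submodule.sum_mem _ fun i _ => Submodule.smul_mem _ _ (Submodule.subset_span ⟨i, rfl⟩)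

theorem lie_fieldGerm {i j : Fin 12} (h : i ≤ j) :
    ⁅fieldGerm S i, fieldGerm S j⁆ = commTable (fieldGerm S) i j := by
  refine autCRToGerm_injective ?_
  rw [map_commTable]
  simp only [autCRToGerm_fieldGerm]
  rw [← map_commTable, ← lieBracket_fieldX_eq_commTable h]
  rfl

end

theorem theorem5p2 (S : Set C9) (hSM : S ⊆ M1) (hS0 : (0 : C9) ∈ S) (hS : IsPreconnected S) :
    Module.finrank ℝ (autCR S) = 12 ∧
    ∃ X : Module.Basis (Fin 12) ℝ (autCR S),
      (∀ i, ((X i : holGerms S) : Germ (𝓝ˢ S) C9) = (fieldX i : C9 → C9)) ∧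
      Nonempty (GradedLieAlgebra (gradedPiece X)) ∧
      ∀ i j, i ≤ j → ⁅X i, X j⁆ = commTable X i j := by
  let X := Module.Basis.mk (linearIndependent_fieldGerm hS0) (span_fieldGerm hS0 hS)
  have hX : ⇑X = fieldGerm S := Module.Basis.coe_mk _ _
  have hb : ∀ i j, i ≤ j → ⁅X i, X j⁆ = commTable X i j := by
    intro i j h
    rw [hX]
    exact lie_fieldGerm h
  refine ⟨by simpa using Module.finrank_eq_card_basis X, X, fun i => ?_,
    nonempty_gradedLieAlgebra X hb, hb⟩
  rw [hX]
  rfl
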